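/- Let $n\ge 3$ and $\alpha>-1$, let $\mathbb B_n$ be the open unit ball of $\mathbb R^n$, let $\nu$ be Lebesgue measure on $\mathbb B_n$ normalized by $\nu(\mathbb B_n)=1$, and let $d\nu_\alpha(x)=c_\alpha(1-|x|^2)^\alpha\,d\nu(x)$, with $c_\alpha$ chosen so that $\nu_\alpha(\mathbb B_n)=1$. For a Euclidean ball $B\subset\partial\mathbb B_n$, i.e. $B=\{y\in\partial\mathbb B_n: |y-x|<s\}$ with $x\in\partial\mathbb B_n$ and $s>0$, let $$\widehat B=\Big\{z\in\mathbb B_n:\ \tfrac{z}{|z|}\in B,\ 1-\tfrac12\operatorname{diam}(B)<|z|<1\Big\}.$$ A weight is a non-negative $\nu_\alpha$-integrable function $\omega$ on $\mathbb B_n$. For $1<p<\infty$ and $\frac1p+\frac1{p'}=1$ put $$[\omega]_{p,\alpha}=\sup_{B}\ \frac{1}{\nu_\alpha(\widehat B)}\int_{\widehat B}\omega\,d\nu_\alpha\ \left(\frac{1}{\nu_\alpha(\widehat B)}\int_{\widehat B}\omega^{1-p'}\,d\nu_\alpha\right)^{p-1},$$ the supremum being over all Euclidean balls $B\subset\partial\mathbb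 B_n$, with $\omega^{1-p'}=\infty$ where $\omega=0$ and with $0\cdot\infty=0$; $\omega$ is a $B_{p,\alpha}$ weight if $[\omega]_{p,\alpha}<\infty$. Let $R$ be a (not necessarily linear) operator that maps complex measurable functions on $\mathbb B_n$ to complex measurable functions on $\mathbb B_n$, functions being identified when they agree $\nu_\alpha$-a.e., and let $\|R\|_{L^p(\omega d\nu_\alpha)\to L^p(\omega d\nu_\alpha)}\in[0,\infty]$ be the least $C$ such that $\|Rf\|_{L^p(\omega d\nu_\alpha)}\le C\|f\|_{L^p(\omega d\nu_\alpha)}$ for all $f\in L^p(\omega d\nu_\alpha)$ (and $\infty$ if there is no such $C$). Suppose there is a constant $C_8<\infty$, independent of $\omega$, such that $$\|R\|_{L^2(\omega d\nu_\alpha)\to L^2(\omega d\nu_\alpha)}\le C_8\,[\omega]_{2,\alpha}\quad\text{for all } B_{2,\alpha}\text{ weights }\omega .$$ Then for every $p>2$ there is a constant $C_9<\infty$, independent of $\omega$, such that $$\|R\|_{L^p(\omega d\nu_\alpha)\to L^p(\omega d\nu_\alpha)}\le C_9\,[\omega]_{p,\alpha}\quad\text{for all } B_{p,\alpha}\text{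 weights }\omega .$$ -/

import Mathlib

open MeasureTheory Metric
open scoped NNReal ENNReal

namespace BekolleBonami

noncomputable section

/-- Lebesgue measure on the open unit ball of `ℝⁿ`, normalized to total mass one. -/
def ballMeasure (n : ℕ) : Measure (EuclideanSpace ℝ (Fin n)) :=
  (volume (ball (0 : EuclideanSpace ℝ (Fin n)) 1))⁻¹ •
    volume.restrict (ball (0 : EuclideanSpace ℝ (Fin n)) 1)

/-- The normalizing constant `c_α = (∫ (1 - |x|²)^α dν(x))⁻¹`. -/
def normConst (n : ℕ) (α : ℝ) : ℝ≥0∞ :=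
  (∫⁻ x, ENNReal.ofReal ((1 - ‖x‖ ^ 2) ^ α) ∂(ballMeasure n))⁻¹

/-- The measure `dν_α(x) = c_α (1 - |x|²)^α dν(x)`. It is carried by the open unit ball, so
values of functions outside the ball play no role. -/
def nu (n : ℕ) (α : ℝ) : Measure (EuclideanSpace ℝ (Fin n)) :=
  normConst n α • (ballMeasure n).withDensity fun x => ENNReal.ofReal ((1 - ‖x‖ ^ 2) ^ α)

/-- The Euclidean ball with centre `x` and radius `s` in the unit sphere. -/
def sphereBall {n : ℕ} (x : EuclideanSpace ℝ (Fin n)) (s : ℝ) :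
    Set (EuclideanSpace ℝ (Fin n)) :=
  {y | y ∈ sphere (0 : EuclideanSpace ℝ (Fin n)) 1 ∧ dist y x < s}

/-- The Carleson box over a subset `E` of the unit sphere. -/
def carlesonBox {n : ℕ} (E : Set (EuclideanSpace ℝ (Fin n))) :
    Set (EuclideanSpace ℝ (Fin n)) :=
  {z | z ∈ ball (0 : EuclideanSpace ℝ (Fin n)) 1 ∧ ‖z‖⁻¹ • z ∈ E ∧
    1 - diam E / 2 < ‖z‖ ∧ ‖z‖ < 1}

/-- A weight: a non-negative function on the unit ball that is integrable for `ν_α`. -/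
structure IsWeight {n : ℕ} (α : ℝ) (ω : EuclideanSpace ℝ (Fin n) → ℝ) : Prop where
  nonneg : ∀ x ∈ ball (0 : EuclideanSpace ℝ (Fin n)) 1, 0 ≤ ω x
  integrable : Integrable ω (nu n α)

/-- The Bekollé-Bonami constant `[ω]_{p,α}`. The exponent `1 - p'` with `1/p + 1/p' = 1`
is `1 - p / (p - 1)`, and `ω ^ (1 - p')` is `∞` where `ω = 0`. -/
def bbConst {n : ℕ} (p α : ℝ) (ω : EuclideanSpace ℝ (Fin n) → ℝ) : ℝ≥0∞ :=
  ⨆ x ∈ sphere (0 : EuclideanSpace ℝ (Fin n)) 1, ⨆ s ∈ Set.Ioi (0 : ℝ),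
    (∫⁻ z in carlesonBox (sphereBall x s), ENNReal.ofReal (ω z) ∂(nu n α)) /
        nu n α (carlesonBox (sphereBall x s)) *
      ((∫⁻ z in carlesonBox (sphereBall x s),
            ENNReal.ofReal (ω z) ^ (1 - p / (p - 1)) ∂(nu n α)) /
          nu n α (carlesonBox (sphereBall x s))) ^ (p - 1)

/-- `ω` is a `B_{p,α}` weight. -/
structure IsBBWeight {n : ℕ} (p α : ℝ) (ω : EuclideanSpace ℝ (Fin n) → ℝ) : Prop where
  isWeight : IsWeight α ω
  bbConst_lt_top : bbConst p α ω < ∞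

/-- The measure `ω dν_α`. -/
def weightedMeasure {n : ℕ} (α : ℝ) (ω : EuclideanSpace ℝ (Fin n) → ℝ) :
    Measure (EuclideanSpace ℝ (Fin n)) :=
  (nu n α).withDensity fun x => ENNReal.ofReal (ω x)

/-- The operator norm of `R` from `L^p(ω dν_α)` to itself: the least `C ∈ [0, ∞]` with
`‖R f‖ ≤ C ‖f‖` for all `f ∈ L^p(ω dν_α)`, where `‖R f‖ = ∞` if `R f ∉ L^p(ω dν_α)`; it is `∞`
if `R` is not bounded. `R` acts on `ν_α`-a.e. classes of measurable functions, need not be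
linear, and only its values on `L^p(ω dν_α)` matter. -/
def opNorm {n : ℕ} {α : ℝ} (p : ℝ) (ω : EuclideanSpace ℝ (Fin n) → ℝ)
    (R : (EuclideanSpace ℝ (Fin n) →ₘ[nu n α] ℂ) → (EuclideanSpace ℝ (Fin n) →ₘ[nu n α] ℂ)) :
    ℝ≥0∞ :=
  sInf {C : ℝ≥0∞ | ∀ f : EuclideanSpace ℝ (Fin n) →ₘ[nu n α] ℂ,
    MemLp f (ENNReal.ofReal p) (weightedMeasure α ω) →
      eLpNorm (R f) (ENNReal.ofReal p) (weightedMeasure α ω) ≤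
        C * eLpNorm f (ENNReal.ofReal p) (weightedMeasure α ω)}

end

end BekolleBonami

/-!
The argument is sharp Rubio de Francia extrapolation, for the maximal function over Carleson boxes.
Write `p' = p / (p - 1)`, `t = (p - 2) / (p - 1)`, let `w` be a `B_{p,α}` weight with constant `A`,
and let `g = |R f|`. By duality, `∫ g^p w` is the integral of `g² h w` with `h = g^(p-2)`. The
weight `h w` equals `U^t w^(1-t)` with `U = g^(p-1) w`. If `U` is replaced by a majorant `G` with
the `A₁` property `avg_B G ≤ K G` on every box `B`, then Hölder's inequality shows that `Ω = G^t
w^(1-t)` has `B_{2,α}` constant at most `K^t A^(1-t)` (`average_mul_average_inv_le`). The hypothesis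
applies to `Ω`, and another application of Hölder's inequality returns to `∫ |f|^p w`
(`lintegral_sq_mul_le`, `lintegral_rpow_mul_le_of_forall_sq`).

The majorant is `G = ∑ (2Λ)⁻ᵏ Mᵏ U` (`exists_majorant_maximalFn_le`), where `M` is a maximal
operator with norm `Λ` on `L^{p'}(w^{1-p'})`. It has `K` comparable to `Λ`, so the bound for `Ω` is
linear in `A` as soon as `Λ` is. That is Buckley's theorem, in the proof due to Lerner: for a nested
family, weighted maximal operators are bounded with constants that do not depend on the weight
(`lintegral_maximalFn_rpow_le`), and `M` is dominated by `A` times a composition of two of them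
(`maximalFn_le_mul_rpow`).

Carleson boxes are not nested, so `M` is taken over tents above the dyadic cubes of finitely many
shifted grids in the ambient space. Every box lies in a tent that lies in a box of comparable size
(`exists_tent_between`), and `ν_α` is doubling on boxes (`nu_carlesonBox_doubling`), which follows
from polar coordinates.
-/

namespace BekolleBonami

/-! ### The maximal function of a dyadic family -/

section DyadicMaximal

variable {X κ : Type*} [MeasurableSpace X]

/-- A family of measurable sets that behaves like dyadic cubes: `lev i` is the generation of `T i`
(larger means smaller sets), two different members of the same generation are disjoint, and a
member of a later generation is disjoint from, or contained in, each earlier one. -/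
structure IsDyadicFamily (T : κ → Set X) (lev : κ → ℕ) : Prop where
  measurableSet : ∀ i, MeasurableSet (T i)
  nested : ∀ i j, i ≠ j → lev i ≤ lev j →
    Disjoint (T i) (T j) ∨ (lev i < lev j ∧ T j ⊆ T i)

/-- The maximal function `x ↦ sup_{i : x ∈ T i} μ(T i)⁻¹ ∫_{T i} f dμ` of a family of sets. It is
`0` at points that no member contains. -/
noncomputable def maximalFn (μ : Measure X) (T : κ → Set X) (f : X → ℝ≥0∞) (x : X) : ℝ≥0∞ :=
  ⨆ i, (T i).indicator (fun _ => (∫⁻ y in T i, f y ∂μ) / μ (T i)) x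

variable {μ : Measure X} {T : κ → Set X} {lev : κ → ℕ}

theorem lt_maximalFn_iff {f : X → ℝ≥0∞} {x : X} {a : ℝ≥0∞} :
    a < maximalFn μ T f x ↔ ∃ i, x ∈ T i ∧ a < (∫⁻ y in T i, f y ∂μ) / μ (T i) := by
  rw [maximalFn, lt_iSup_iff]
  refine exists_congr fun i => ?_
  by_cases hx : x ∈ T i <;> simp [hx]

theorem average_le_maximalFn (f : X → ℝ≥0∞) {x : X} {i : κ} (hx : x ∈ T i) :
    (∫⁻ y in T i, f y ∂μ) / μ (T i) ≤ maximalFn μ T f x := by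
  refine le_trans ?_ (le_iSup _ i)
  simp [hx]

theorem measurable_maximalFn [Countable κ] (hT : ∀ i, MeasurableSet (T i)) (f : X → ℝ≥0∞) :
    Measurable (maximalFn μ T f) :=
  Measurable.iSup fun i => measurable_const.indicator (hT i)

theorem maximalFn_le_iff {f : X → ℝ≥0∞} {x : X} {a : ℝ≥0∞} :
    maximalFn μ T f x ≤ a ↔ ∀ i, x ∈ T i → (∫⁻ y in T i, f y ∂μ) / μ (T i) ≤ a := by
  rw [← not_lt, lt_maximalFn_iff]
  push Not
  rfl

theorem maximalFn_tsum_le {f : ℕ → X → ℝ≥0∞} (hf : ∀ k, Measurable (f k)) (x : X) :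
    maximalFn μ T (fun y => ∑' k, f k y) x ≤ ∑' k, maximalFn μ T (f k) x := by
  rw [maximalFn_le_iff]
  intro i hx
  rw [lintegral_tsum fun k => (hf k).aemeasurable, div_eq_mul_inv, ← ENNReal.tsum_mul_right]
  exact ENNReal.tsum_le_tsum fun k => average_le_maximalFn (f k) hx

theorem maximalFn_const_mul {f : X → ℝ≥0∞} (hf : Measurable f) (c : ℝ≥0∞) (x : X) :
    maximalFn μ T (fun y => c * f y) x ≤ c * maximalFn μ T f x := by
  rw [maximalFn_le_iff]
  intro i hx
  rw [lintegral_const_mul _ hf, mul_div_assoc]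
  gcongr
  exact average_le_maximalFn f hx

/-- The weak-type `(1,1)` inequality with constant one, for an arbitrary measure: the level set is
the disjoint union of the members of least generation on which the average exceeds `a`. -/
theorem mul_measure_maximalFn_le [Countable κ] (hT : IsDyadicFamily T lev) (f : X → ℝ≥0∞)
    (a : ℝ≥0∞) : a * μ {x | a < maximalFn μ T f x} ≤ ∫⁻ x, f x ∂μ := by
  classical
  set P : κ → Prop := fun i => a < (∫⁻ y in T i, f y ∂μ) / μ (T i) with hP
  -- The members of least generation among those whose average exceeds `a`.
  set J : Set κ := {i | P i ∧ ∀ j, P j → lev j < lev i → Disjoint (T j) (T i)} with hJ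
  have hsub : {x | a < maximalFn μ T f x} ⊆ ⋃ i : J, T i := by
    intro x hx
    have hx' : ∃ k, ∃ i, lev i = k ∧ x ∈ T i ∧ P i := by
      obtain ⟨i, hi, hPi⟩ := lt_maximalFn_iff.1 hx
      exact ⟨_, i, rfl, hi, hPi⟩
    obtain ⟨i, hik, hxi, hPi⟩ := Nat.find_spec hx'
    refine Set.mem_iUnion.2 ⟨⟨i, hPi, fun j hPj hlt => ?_⟩, hxi⟩
    by_contra hdis
    have hne : j ≠ i := by rintro rfl; exact lt_irrefl _ hlt
    rcases hT.nested j i hne hlt.le with h | ⟨-, h⟩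
    · exact hdis h
    · exact Nat.find_min hx' (m := lev j) (by omega) ⟨j, rfl, h hxi, hPj⟩
  have hdisj : Pairwise (Function.onFun Disjoint fun i : J => T i) := by
    have key : ∀ i j : J, i ≠ j → lev i ≤ lev j → Disjoint (T i) (T j) := by
      intro i j hij hle
      rcases hT.nested i j (fun h => hij (Subtype.ext h)) hle with h | ⟨hlt, -⟩
      · exact h
      · exact j.2.2 i i.2.1 hlt
    intro i j hij
    rcases le_total (lev i) (lev j) with h | h
    · exact key i j hij h
    · exact (key j i hij.symm h).symm
  calc a * μ {x | a < maximalFn μ T f x} ≤ a * ∑' i : J, μ (T i) := by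
        gcongr
        exact (measure_mono hsub).trans (measure_iUnion_le _)
    _ = ∑' i : J, a * μ (T i) := ENNReal.tsum_mul_left.symm
    _ ≤ ∑' i : J, ∫⁻ y in T i, f y ∂μ :=
        ENNReal.tsum_le_tsum fun i => (ENNReal.mul_lt_of_lt_div i.2.1).le
    _ = ∫⁻ y in ⋃ i : J, T i, f y ∂μ :=
        (lintegral_iUnion (fun i : J => hT.measurableSet i) hdisj f).symm
    _ ≤ ∫⁻ x, f x ∂μ := setLIntegral_le_lintegral _ _

/-- The weak-type inequality in the form that integrates to the strong one: only the part of `f`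
above `a / 2` contributes to the level set of its maximal function. -/
theorem mul_measure_maximalFn_le_setLIntegral [Countable κ] (hT : IsDyadicFamily T lev)
    {f : X → ℝ≥0∞} (hf : Measurable f) (a : ℝ≥0∞) :
    a * μ {x | a < maximalFn μ T f x} ≤ 2 * ∫⁻ x in {x | a < 2 * f x}, f x ∂μ := by
  have hm : MeasurableSet {x | a < 2 * f x} :=
    measurableSet_lt measurable_const (hf.const_mul 2)
  set g : X → ℝ≥0∞ := {x | a < 2 * f x}.indicator f with hg
  have hfg : ∀ y, f y ≤ g y + a / 2 := by
    intro y
    by_cases hy : a < 2 * f y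
    · have : g y = f y := Set.indicator_of_mem (s := {x | a < 2 * f x}) hy f
      rw [this]; exact le_self_add
    · refine le_trans ?_ le_add_self
      rw [ENNReal.le_div_iff_mul_le (by simp) (by simp), mul_comm]
      exact not_lt.1 hy
  have hsub : {x | a < maximalFn μ T f x} ⊆ {x | a / 2 < maximalFn μ T g x} := by
    intro x hx
    obtain ⟨i, hxi, hi⟩ := lt_maximalFn_iff.1 hx
    refine lt_maximalFn_iff.2 ⟨i, hxi, ?_⟩
    have h1 : (∫⁻ y in T i, f y ∂μ) / μ (T i) ≤ (∫⁻ y in T i, g y ∂μ) / μ (T i) + a / 2 := by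
      calc (∫⁻ y in T i, f y ∂μ) / μ (T i)
          ≤ (∫⁻ y in T i, (g y + a / 2) ∂μ) / μ (T i) := by gcongr with y; exact hfg y
        _ = (∫⁻ y in T i, g y ∂μ) / μ (T i) + a / 2 * μ (T i) / μ (T i) := by
            rw [lintegral_add_right _ measurable_const, lintegral_const,
              Measure.restrict_apply_univ, ENNReal.add_div]
        _ ≤ (∫⁻ y in T i, g y ∂μ) / μ (T i) + a / 2 :=
            add_le_add_right (ENNReal.div_le_of_le_mul le_rfl) _
    have h2 : a / 2 + a / 2 < (∫⁻ y in T i, g y ∂μ) / μ (T i) + a / 2 := by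
      rw [ENNReal.add_halves]; exact hi.trans_le h1
    exact lt_of_add_lt_add_right h2
  calc a * μ {x | a < maximalFn μ T f x}
      = 2 * (a / 2 * μ {x | a < maximalFn μ T f x}) := by
        rw [← mul_assoc, ENNReal.mul_div_cancel (by simp) (by simp)]
    _ ≤ 2 * (a / 2 * μ {x | a / 2 < maximalFn μ T g x}) := by gcongr
    _ ≤ 2 * ∫⁻ x, g x ∂μ := by gcongr; exact mul_measure_maximalFn_le hT g _
    _ = _ := by rw [hg, lintegral_indicator hm]

theorem setLIntegral_Ioo_rpow {β b : ℝ} (hβ : -1 < β) (hb : 0 ≤ b) :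
    ∫⁻ u in Set.Ioo 0 b, ENNReal.ofReal (u ^ β) = ENNReal.ofReal (b ^ (β + 1) / (β + 1)) := by
  have hint : IntervalIntegrable (fun u : ℝ => u ^ β) volume 0 b :=
    intervalIntegral.intervalIntegrable_rpow' hβ
  rw [restrict_Ioo_eq_restrict_Ioc, ← ofReal_integral_eq_lintegral_ofReal hint.1,
    ← intervalIntegral.integral_of_le hb, integral_rpow (Or.inl hβ),
    Real.zero_rpow (by linarith), sub_zero]
  filter_upwards [ae_restrict_mem measurableSet_Ioc] with u hu
  exact Real.rpow_nonneg hu.1.le _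

/-- The layer-cake identity `a ^ r = r ∫₀^∞ t ^ (r - 1) 1_{t < a} dt`, including `a = ∞`. -/
theorem lintegral_indicator_rpow (a : ℝ≥0∞) {r : ℝ} (hr : 0 < r) :
    ENNReal.ofReal r * ∫⁻ t in Set.Ioi (0 : ℝ),
      {t : ℝ | ENNReal.ofReal t < a}.indicator (fun t => ENNReal.ofReal (t ^ (r - 1))) t
      = a ^ r := by
  have hm : ∀ a : ℝ≥0∞, MeasurableSet {t : ℝ | ENNReal.ofReal t < a} := fun a =>
    measurableSet_lt ENNReal.measurable_ofReal measurable_const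
  have fin : ∀ b : ℝ, 0 ≤ b → ENNReal.ofReal r * ∫⁻ t in Set.Ioi (0 : ℝ),
      {t : ℝ | ENNReal.ofReal t < ENNReal.ofReal b}.indicator
        (fun t => ENNReal.ofReal (t ^ (r - 1))) t = ENNReal.ofReal b ^ r := by
    intro b hb
    -- For finite `a` the indicator restricts the integral to a bounded interval.
    have hset : {t : ℝ | ENNReal.ofReal t < ENNReal.ofReal b} ∩ Set.Ioi 0 = Set.Ioo 0 b := by
      ext t
      simp only [Set.mem_inter_iff, Set.mem_ofPred_eq, Set.mem_Ioi, Set.mem_Ioo]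
      constructor
      · rintro ⟨h, h0⟩
        exact ⟨h0, (ENNReal.ofReal_lt_ofReal_iff_of_nonneg h0.le).1 h⟩
      · rintro ⟨h0, h⟩
        exact ⟨(ENNReal.ofReal_lt_ofReal_iff_of_nonneg h0.le).2 h, h0⟩
    rw [lintegral_indicator (hm _), Measure.restrict_restrict (hm _), hset,
      setLIntegral_Ioo_rpow (by linarith) hb, sub_add_cancel, ← ENNReal.ofReal_mul hr.le,
      mul_div_cancel₀ _ hr.ne', ENNReal.ofReal_rpow_of_nonneg hb hr.le]
  rcases eq_or_ne a ∞ with rfl | ha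
  · rw [ENNReal.top_rpow_of_pos hr, eq_top_iff]
    refine le_of_forall_lt fun c hc => ?_
    lift c to ℝ≥0 using hc.ne
    obtain ⟨b, hb⟩ := exists_nat_gt ((c : ℝ) ^ (1 / r))
    have h1 : (c : ℝ≥0∞) < ENNReal.ofReal b ^ r := by
      rw [ENNReal.ofReal_rpow_of_nonneg (by positivity) hr.le, ← ENNReal.ofReal_coe_nnreal,
        ENNReal.ofReal_lt_ofReal_iff_of_nonneg (by positivity)]
      calc (c : ℝ) = ((c : ℝ) ^ (1 / r)) ^ r := by
            rw [← Real.rpow_mul c.coe_nonneg, one_div_mul_cancel hr.ne', Real.rpow_one]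
        _ < _ := Real.rpow_lt_rpow (by positivity) hb hr
    refine h1.trans_le ?_
    rw [← fin b (by positivity)]
    gcongr with t
    exact le_top
  · rw [← ENNReal.ofReal_toReal ha]
    exact fin _ ENNReal.toReal_nonneg

/-- The strong-type inequality for a dyadic maximal function. The constant depends on `q` only, and
not on the measure, which need not be doubling. -/
theorem lintegral_maximalFn_rpow_le [Countable κ] [SFinite μ] (hT : IsDyadicFamily T lev)
    {q : ℝ} (hq : 1 < q) {f : X → ℝ≥0∞} (hf : Measurable f) :
    ∫⁻ x, maximalFn μ T f x ^ q ∂μ ≤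
      (ENNReal.ofReal q * 2 ^ q / ENNReal.ofReal (q - 1)) * ∫⁻ x, f x ^ q ∂μ := by
  have hM : Measurable (maximalFn μ T f) := measurable_maximalFn hT.measurableSet f
  have hmeas : ∀ {g : X → ℝ≥0∞}, Measurable g →
      MeasurableSet {z : X × ℝ | ENNReal.ofReal z.2 < g z.1} := fun hg =>
    measurableSet_lt (ENNReal.measurable_ofReal.comp measurable_snd) (hg.comp measurable_fst)
  have hpow : ∀ r : ℝ, Measurable fun t : ℝ => ENNReal.ofReal (t ^ r) := fun r =>
    ENNReal.measurable_ofReal.comp (measurable_id.pow_const r)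
  have step : ∀ t ∈ Set.Ioi (0 : ℝ),
      (∫⁻ x, {t : ℝ | ENNReal.ofReal t < maximalFn μ T f x}.indicator
        (fun t => ENNReal.ofReal (t ^ (q - 1))) t ∂μ) ≤
      2 * ∫⁻ x, f x * {t : ℝ | ENNReal.ofReal t < 2 * f x}.indicator
        (fun t => ENNReal.ofReal (t ^ (q - 1 - 1))) t ∂μ := by
    intro t ht
    have ht : 0 < t := ht
    have e1 : (∫⁻ x, {t : ℝ | ENNReal.ofReal t < maximalFn μ T f x}.indicator
        (fun t => ENNReal.ofReal (t ^ (q - 1))) t ∂μ) =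
        ENNReal.ofReal (t ^ (q - 1)) * μ {x | ENNReal.ofReal t < maximalFn μ T f x} := by
      rw [← lintegral_indicator_const (measurableSet_lt measurable_const hM)]
      rfl
    have e2 : (∫⁻ x, f x * {t : ℝ | ENNReal.ofReal t < 2 * f x}.indicator
        (fun t => ENNReal.ofReal (t ^ (q - 1 - 1))) t ∂μ) =
        ENNReal.ofReal (t ^ (q - 1 - 1)) * ∫⁻ x in {x | ENNReal.ofReal t < 2 * f x}, f x ∂μ := by
      rw [← lintegral_indicator (measurableSet_lt measurable_const (hf.const_mul 2)),
        ← lintegral_const_mul _ (hf.indicator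
          (measurableSet_lt measurable_const (hf.const_mul 2)))]
      refine lintegral_congr fun x => ?_
      by_cases hx : ENNReal.ofReal t < 2 * f x <;> simp [Set.indicator, mul_comm]
    have e3 : ENNReal.ofReal (t ^ (q - 1)) = ENNReal.ofReal (t ^ (q - 1 - 1)) *
        ENNReal.ofReal t := by
      rw [← ENNReal.ofReal_mul (by positivity)]
      congr 1
      nth_rw 3 [← Real.rpow_one t]
      rw [← Real.rpow_add ht]; congr 1; ring
    rw [e1, e2, e3, mul_assoc, mul_left_comm 2]
    refine mul_le_mul_right ?_ _
    exact mul_measure_maximalFn_le_setLIntegral hT hf _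
  have swap1 : ∫⁻ x, (∫⁻ t in Set.Ioi (0 : ℝ),
          {t : ℝ | ENNReal.ofReal t < maximalFn μ T f x}.indicator
        (fun t => ENNReal.ofReal (t ^ (q - 1))) t) ∂μ = ∫⁻ t in Set.Ioi (0 : ℝ), (∫⁻ x,
          {t : ℝ | ENNReal.ofReal t < maximalFn μ T f x}.indicator
        (fun t => ENNReal.ofReal (t ^ (q - 1))) t ∂μ) := by
    refine lintegral_lintegral_swap (Measurable.aemeasurable ?_)
    exact ((hpow (q - 1)).comp measurable_snd).indicator (hmeas hM)
  have hm2 : Measurable (fun z : X × ℝ => f z.1 * {t : ℝ | ENNReal.ofReal t < 2 * f z.1}.indicator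
        (fun t => ENNReal.ofReal (t ^ (q - 1 - 1))) z.2) :=
    (hf.comp measurable_fst).mul
      (((hpow (q - 1 - 1)).comp measurable_snd).indicator (hmeas (hf.const_mul 2)))
  have swap2 : ∫⁻ t in Set.Ioi (0 : ℝ), (∫⁻ x, f x * {t : ℝ | ENNReal.ofReal t < 2 * f x}.indicator
        (fun t => ENNReal.ofReal (t ^ (q - 1 - 1))) t ∂μ) =
      ∫⁻ x, (∫⁻ t in Set.Ioi (0 : ℝ), f x * {t : ℝ | ENNReal.ofReal t < 2 * f x}.indicator
        (fun t => ENNReal.ofReal (t ^ (q - 1 - 1))) t) ∂μ :=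
    (lintegral_lintegral_swap hm2.aemeasurable).symm
  have hq1 : ENNReal.ofReal (q - 1) ≠ 0 := by simpa using hq
  calc ∫⁻ x, maximalFn μ T f x ^ q ∂μ
      = ENNReal.ofReal q * ∫⁻ t in Set.Ioi (0 : ℝ), (∫⁻ x,
          {t : ℝ | ENNReal.ofReal t < maximalFn μ T f x}.indicator
        (fun t => ENNReal.ofReal (t ^ (q - 1))) t ∂μ) := by
        rw [← swap1, ← lintegral_const_mul' _ _ ENNReal.ofReal_ne_top]
        exact lintegral_congr fun x => (lintegral_indicator_rpow _ (by linarith)).symm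
    _ ≤ ENNReal.ofReal q * ∫⁻ t in Set.Ioi (0 : ℝ), 2 * (∫⁻ x, f x *
          {t : ℝ | ENNReal.ofReal t < 2 * f x}.indicator
        (fun t => ENNReal.ofReal (t ^ (q - 1 - 1))) t ∂μ) := by
        gcongr 1
        exact setLIntegral_mono' measurableSet_Ioi step
    _ = ENNReal.ofReal q *
          (2 * ∫⁻ x, f x * ((ENNReal.ofReal (q - 1))⁻¹ * (2 * f x) ^ (q - 1)) ∂μ) := by
        rw [lintegral_const_mul' _ _ (by simp), swap2]
        congr 2
        refine lintegral_congr fun x => ?_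
        rw [lintegral_const_mul _ ((hpow _).indicator
            (measurableSet_lt ENNReal.measurable_ofReal measurable_const)),
          ← lintegral_indicator_rpow _ (sub_pos.2 hq), ← mul_assoc _ (ENNReal.ofReal (q - 1)),
          ENNReal.inv_mul_cancel hq1 ENNReal.ofReal_ne_top, one_mul]
    _ = _ := by
        rw [← lintegral_const_mul' _ _ (by simp), ← lintegral_const_mul' _ _ (by simp),
          ← lintegral_const_mul' _ _ ?_]
        · refine lintegral_congr fun x => ?_
          have h1 : f x ^ q = f x * f x ^ (q - 1) := by
            have := ENNReal.rpow_add_of_nonneg (x := f x) 1 (q - 1) zero_le_one (by linarith)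
            rwa [ENNReal.rpow_one, add_sub_cancel] at this
          have h2 : (2 : ℝ≥0∞) ^ q = 2 * 2 ^ (q - 1) := by
            have := ENNReal.rpow_add_of_nonneg (x := 2) 1 (q - 1) zero_le_one (by linarith)
            rwa [ENNReal.rpow_one, add_sub_cancel] at this
          rw [h1, h2, ENNReal.mul_rpow_of_nonneg _ _ (by linarith), div_eq_mul_inv]
          ring
        · exact ENNReal.div_ne_top (ENNReal.mul_ne_top ENNReal.ofReal_ne_top
            (ENNReal.rpow_ne_top_of_nonneg (by linarith) (by simp))) hq1

end DyadicMaximal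

/-! ### The sharp weighted bound for dyadic maximal functions -/

section Buckley

variable {X κ : Type*} [MeasurableSpace X] {μ : Measure X} {T : κ → Set X}

theorem setLIntegral_withDensity_div {w g : X → ℝ≥0∞} (hw : Measurable w)
    (hw0 : ∀ x, w x ≠ 0) (hwt : ∀ x, w x ≠ ∞) (hg : Measurable g) {s : Set X}
    (hs : MeasurableSet s) :
    ∫⁻ x in s, g x / w x ∂(μ.withDensity w) = ∫⁻ x in s, g x ∂μ := by
  have hgw : Measurable fun x => g x / w x := hg.div hw
  rw [setLIntegral_withDensity_eq_setLIntegral_mul _ hw hgw hs]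
  refine lintegral_congr fun x => ?_
  exact ENNReal.mul_div_cancel (hw0 x) (hwt x)

theorem setLIntegral_ne_zero {f : X → ℝ≥0∞} (hf : Measurable f) (hf0 : ∀ x, f x ≠ 0) {s : Set X}
    (hs : μ s ≠ 0) : ∫⁻ x in s, f x ∂μ ≠ 0 := by
  intro h
  rw [lintegral_eq_zero_iff hf] at h
  have : ∀ᵐ y ∂(μ.restrict s), False := h.mono fun y hy => hf0 y hy
  rw [Filter.eventually_false_iff_eq_bot, ae_eq_bot, Measure.restrict_eq_zero] at this
  exact hs this

/-- The pointwise estimate behind Buckley's theorem: with `v` in the role of the dual weight of `w`,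
the unweighted maximal function is dominated by a composition of a `w`-weighted and a `v`-weighted
one, at the cost of a single factor `A`. -/
theorem maximalFn_le_mul_rpow {p : ℝ} (hp : 1 < p) (hT : ∀ i, MeasurableSet (T i)) [Countable κ]
    (hT0 : ∀ i, μ (T i) ≠ 0) (hTt : ∀ i, μ (T i) ≠ ∞)
    {w v u : X → ℝ≥0∞} (hw : Measurable w) (hw0 : ∀ x, w x ≠ 0) (hwt : ∀ x, w x ≠ ∞)
    (hv : Measurable v) (hv0 : ∀ x, v x ≠ 0) (hvt : ∀ x, v x ≠ ∞) (hu : Measurable u)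
    (hwi : ∫⁻ x, w x ∂μ ≠ ∞) (hvi : ∫⁻ x, v x ∂μ ≠ ∞) {A : ℝ≥0∞}
    (hA : ∀ i, (∫⁻ x in T i, w x ∂μ) / μ (T i) * ((∫⁻ x in T i, v x ∂μ) / μ (T i)) ^ (p - 1) ≤ A)
    (x : X) :
    maximalFn μ T u x ≤ A * maximalFn (μ.withDensity v) T (fun y =>
      maximalFn (μ.withDensity w) T (fun z => u z / w z) y ^ (1 / (p - 1)) / v y) x ^ (p - 1) := by
  have hp1 : 0 < p - 1 := by linarith
  set F := maximalFn (μ.withDensity w) T (fun z => u z / w z) with hF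
  have hFm : Measurable F := measurable_maximalFn hT _
  rw [maximalFn_le_iff]
  intro i hxi
  have fin : ∀ {f : X → ℝ≥0∞}, ∫⁻ x, f x ∂μ ≠ ∞ → ∫⁻ x in T i, f x ∂μ ≠ ∞ := fun h =>
    ne_top_of_le_ne_top h (setLIntegral_le_lintegral _ _)
  set m := μ (T i) with hm
  set W := ∫⁻ x in T i, w x ∂μ with hW
  set V := ∫⁻ x in T i, v x ∂μ with hV
  set I := ∫⁻ x in T i, u x ∂μ with hI
  have hm0 : m ≠ 0 := hT0 i
  have hmt : m ≠ ∞ := hTt i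
  have hW0 : W ≠ 0 := setLIntegral_ne_zero hw hw0 (hT0 i)
  have hWt : W ≠ ∞ := fin hwi
  have hV0 : V ≠ 0 := setLIntegral_ne_zero hv hv0 (hT0 i)
  have hVt : V ≠ ∞ := fin hvi
  -- `c` is the average of `u / w` for `w dμ`; it is bounded by the weighted maximal function `F` on
  -- all of `T i`, so that the average of `F ^ (1 / (p - 1)) / v` for `v dμ` is bounded below.
  set c := I / W with hc
  have hcF : ∀ y ∈ T i, c ≤ F y := by
    intro y hy
    have := average_le_maximalFn (μ := μ.withDensity w) (fun z => u z / w z) hy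
    rwa [setLIntegral_withDensity_div hw hw0 hwt hu (hT i), withDensity_apply _ (hT i)] at this
  have hN := average_le_maximalFn (μ := μ.withDensity v) (fun y => F y ^ (1 / (p - 1)) / v y) hxi
  rw [setLIntegral_withDensity_div hv hv0 hvt (hFm.pow_const _) (hT i),
    withDensity_apply _ (hT i)] at hN
  have hcm : c ^ (1 / (p - 1)) * m ≤ ∫⁻ y in T i, F y ^ (1 / (p - 1)) ∂μ := by
    rw [hm, ← setLIntegral_const]
    refine setLIntegral_mono' (hT i) fun y hy => ?_
    exact ENNReal.rpow_le_rpow (hcF y hy) (by positivity)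
  have hN2 : c ^ (1 / (p - 1)) * m / V ≤
      maximalFn (μ.withDensity v) T (fun y => F y ^ (1 / (p - 1)) / v y) x :=
    le_trans (by gcongr) hN
  calc I / m = W / m * (V / m) ^ (p - 1) * (c ^ (1 / (p - 1)) * m / V) ^ (p - 1) := by
        have e1 : (c ^ (1 / (p - 1)) * m / V) ^ (p - 1) = c * (m / V) ^ (p - 1) := by
          rw [mul_div_assoc, ENNReal.mul_rpow_of_nonneg _ _ hp1.le, ← ENNReal.rpow_mul,
            one_div_mul_cancel hp1.ne', ENNReal.rpow_one]
        have e2 : (V / m) ^ (p - 1) * (m / V) ^ (p - 1) = 1 := by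
          rw [← ENNReal.mul_rpow_of_nonneg _ _ hp1.le,
            ← ENNReal.inv_div (by simp [hVt]) (by simp [hV0]),
            ENNReal.inv_mul_cancel, ENNReal.one_rpow]
          · exact (ENNReal.div_pos hm0 hVt).ne'
          · exact ENNReal.div_ne_top hmt hV0
        rw [e1, mul_assoc, mul_left_comm _ c, e2, mul_one, hc, mul_comm, ← mul_div_assoc,
          ENNReal.div_mul_cancel hW0 hWt]
    _ ≤ _ := by
        gcongr
        exact hA i

/-- Buckley's theorem for dyadic families: on `L^{p'}(w^{1-p'})`, where `p' = p / (p - 1)` and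
`1 - p' = -1 / (p - 1)`, the norm of the maximal operator is at most linear in the constant `A`
of `w`. This linearity is what makes the extrapolation sharp. -/
theorem lintegral_maximalFn_rpow_mul_le {p : ℝ} (hp : 1 < p) :
    ∃ C : ℝ≥0, ∀ {X κ : Type*} [MeasurableSpace X] {μ : Measure X} [SFinite μ] [Countable κ]
      {T : κ → Set X} {lev : κ → ℕ} (_ : IsDyadicFamily T lev)
      (_ : ∀ i, μ (T i) ≠ 0) (_ : ∀ i, μ (T i) ≠ ∞)
      {w u : X → ℝ≥0∞} (_ : Measurable w) (_ : ∀ x, w x ≠ 0) (_ : ∀ x, w x ≠ ∞)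
      (_ : Measurable u)
      (_ : ∫⁻ x, w x ∂μ ≠ ∞) (_ : ∫⁻ x, w x ^ (-1 / (p - 1)) ∂μ ≠ ∞) {A : ℝ≥0∞}
      (_ : ∀ i, (∫⁻ x in T i, w x ∂μ) / μ (T i) *
        ((∫⁻ x in T i, w x ^ (-1 / (p - 1)) ∂μ) / μ (T i)) ^ (p - 1) ≤ A),
      ∫⁻ x, maximalFn μ T u x ^ (p / (p - 1)) * w x ^ (-1 / (p - 1)) ∂μ ≤
        C * A ^ (p / (p - 1)) * ∫⁻ x, u x ^ (p / (p - 1)) * w x ^ (-1 / (p - 1)) ∂μ := by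
  have hp1 : 0 < p - 1 := by linarith
  have hq : 1 < p / (p - 1) := by rw [lt_div_iff₀ hp1]; linarith
  set c : ℝ → ℝ≥0∞ := fun q => ENNReal.ofReal q * 2 ^ q / ENNReal.ofReal (q - 1) with hc
  have hct : ∀ q, 1 < q → c q ≠ ∞ := fun q hq =>
    ENNReal.div_ne_top (ENNReal.mul_ne_top ENNReal.ofReal_ne_top
      (ENNReal.rpow_ne_top_of_nonneg (by linarith) (by simp))) (by simpa using hq)
  refine ⟨(c p * c (p / (p - 1))).toNNReal, ?_⟩
  rw [ENNReal.coe_toNNReal (ENNReal.mul_ne_top (hct _ hp) (hct _ hq))]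
  intro X κ _ μ _ _ T lev hT hT0 hTt w u hw hw0 hwt hu hwi hvi A hA
  set q := p / (p - 1) with hqdef
  set v : X → ℝ≥0∞ := fun x => w x ^ (-1 / (p - 1)) with hvdef
  have hv : Measurable v := hw.pow_const _
  have hv0 : ∀ x, v x ≠ 0 := fun x => (ENNReal.rpow_pos (pos_iff_ne_zero.2 (hw0 x)) (hwt x)).ne'
  have hvt : ∀ x, v x ≠ ∞ := fun x => by
    simp only [hvdef, ne_eq, ENNReal.rpow_eq_top_iff, not_or, not_and]
    exact ⟨fun h => absurd h (hw0 x), fun h => absurd h (hwt x)⟩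
  set F := maximalFn (μ.withDensity w) T (fun z => u z / w z) with hF
  have hFm : Measurable F := measurable_maximalFn hT.measurableSet _
  set N := maximalFn (μ.withDensity v) T (fun y => F y ^ (1 / (p - 1)) / v y) with hN
  have hNm : Measurable N := measurable_maximalFn hT.measurableSet _
  have conv : ∀ {g d : X → ℝ≥0∞}, Measurable g → Measurable d →
      ∫⁻ x, g x ∂(μ.withDensity d) = ∫⁻ x, g x * d x ∂μ := by
    intro g d hg hd
    rw [lintegral_withDensity_eq_lintegral_mul _ hd hg]
    exact lintegral_congr fun x => mul_comm _ _
  have m1 : Measurable fun y => F y ^ (1 / (p - 1)) / v y := (hFm.pow_const _).div hv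
  have m2 : Measurable fun y => u y / w y := hu.div hw
  have b1 := lintegral_maximalFn_rpow_le (μ := μ.withDensity v) hT hp
    m1
  have b2 := lintegral_maximalFn_rpow_le (μ := μ.withDensity w) hT hq
    m2
  rw [conv (hNm.pow_const _) hv, conv (m1.pow_const _) hv] at b1
  rw [conv (hFm.pow_const _) hw, conv (m2.pow_const _) hw] at b2
  have e1 : ∀ x, (F x ^ (1 / (p - 1)) / v x) ^ p * v x = F x ^ q * w x := by
    intro x
    rw [ENNReal.div_rpow_of_nonneg _ _ (by linarith), ← ENNReal.rpow_mul, div_eq_mul_inv,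
      mul_assoc]
    congr 1
    · congr 1; rw [hqdef]; ring
    · simp only [hvdef]
      rw [← ENNReal.rpow_neg, ← ENNReal.rpow_mul, ← ENNReal.rpow_add _ _ (hw0 x) (hwt x)]
      nth_rw 2 [← ENNReal.rpow_one (w x)]
      congr 1
      field_simp
      ring
  have e2 : ∀ x, (u x / w x) ^ q * w x = u x ^ q * v x := by
    intro x
    rw [ENNReal.div_rpow_of_nonneg _ _ (by linarith), div_eq_mul_inv, mul_assoc,
      ← ENNReal.rpow_neg]
    congr 1
    simp only [hvdef]
    nth_rw 2 [← ENNReal.rpow_one (w x)]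
    rw [← ENNReal.rpow_add _ _ (hw0 x) (hwt x)]
    congr 1
    rw [hqdef]
    field_simp
    ring
  calc ∫⁻ x, maximalFn μ T u x ^ q * v x ∂μ
      ≤ ∫⁻ x, A ^ q * (N x ^ p * v x) ∂μ := by
        refine lintegral_mono fun x => ?_
        calc maximalFn μ T u x ^ q * v x ≤ (A * N x ^ (p - 1)) ^ q * v x := by
              gcongr
              exact maximalFn_le_mul_rpow hp hT.measurableSet hT0 hTt hw hw0 hwt hv hv0 hvt hu
                hwi hvi hA x
          _ = _ := by
              rw [ENNReal.mul_rpow_of_nonneg _ _ (by linarith), ← ENNReal.rpow_mul, mul_assoc]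
              congr 4
              rw [hqdef]
              field_simp
    _ = A ^ q * ∫⁻ x, N x ^ p * v x ∂μ :=
        lintegral_const_mul _ ((hNm.pow_const _).mul hv)
    _ ≤ A ^ q * (c p * (c q * ∫⁻ x, u x ^ q * v x ∂μ)) := by
        gcongr
        refine b1.trans ?_
        gcongr
        rw [lintegral_congr e1]
        rw [lintegral_congr e2] at b2
        exact b2
    _ = _ := by ring

end Buckley

/-! ### Polar coordinates, spherical caps and radial integrals -/

section PolarCoordinates

variable {n : ℕ}

local notation "E" => EuclideanSpace ℝ (Fin n)

/-- The points of the open unit ball at distance more than `a` from the origin whose radial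
projection to the unit sphere lies in `S`. The origin is excluded. -/
def sector (S : Set (EuclideanSpace ℝ (Fin n))) (a : ℝ) : Set (EuclideanSpace ℝ (Fin n)) :=
  {z | z ≠ 0 ∧ ‖z‖⁻¹ • z ∈ S ∧ a < ‖z‖ ∧ ‖z‖ < 1}

theorem measurable_direction : Measurable fun z : E => ‖z‖⁻¹ • z :=
  measurable_norm.inv.smul measurable_id

theorem measurableSet_sector {S : Set E} (hS : MeasurableSet S) (a : ℝ) :
    MeasurableSet (sector S a) := by
  have h1 : MeasurableSet {z : E | z ≠ 0} := (measurableSet_singleton 0).compl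
  have h2 : MeasurableSet {z : E | ‖z‖⁻¹ • z ∈ S} := measurable_direction hS
  have h3 : MeasurableSet {z : E | a < ‖z‖} := measurableSet_lt measurable_const measurable_norm
  have h4 : MeasurableSet {z : E | ‖z‖ < 1} := measurableSet_lt measurable_norm measurable_const
  exact h1.inter (h2.inter (h3.inter h4))

/-- Integration in polar coordinates over the cone above a subset `S` of the unit sphere. -/
theorem lintegral_cone {S : Set E} (hS : MeasurableSet S) {φ : ℝ → ℝ≥0∞} (hφ : Measurable φ) :
    ∫⁻ z in {z : E | z ≠ 0 ∧ ‖z‖⁻¹ • z ∈ S}, φ ‖z‖ =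
      (volume : Measure E).toSphere (Subtype.val ⁻¹' S) *
        ∫⁻ r in Set.Ioi (0 : ℝ), φ r * ENNReal.ofReal (r ^ (n - 1)) := by
  have hS' : MeasurableSet {z : E | ‖z‖⁻¹ • z ∈ S} := measurable_direction hS
  have h0 : MeasurableSet ({0}ᶜ : Set E) := (measurableSet_singleton 0).compl
  have hset : {z : E | z ≠ 0 ∧ ‖z‖⁻¹ • z ∈ S} = {z : E | ‖z‖⁻¹ • z ∈ S} ∩ {0}ᶜ := by
    ext z; exact and_comm
  have hfin : Module.finrank ℝ E = n := finrank_euclideanSpace_fin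
  have hpres := Measure.measurePreserving_homeomorphUnitSphereProd (volume : Measure E)
  rw [hfin] at hpres
  have hSs : MeasurableSet (Subtype.val ⁻¹' S : Set (sphere (0 : E) 1)) :=
    measurable_subtype_coe hS
  have hφ' : Measurable fun r : Set.Ioi (0 : ℝ) => φ r := hφ.comp measurable_subtype_coe
  have hind : Measurable ((Subtype.val ⁻¹' S : Set (sphere (0 : E) 1)).indicator
      (fun _ => (1 : ℝ≥0∞))) := measurable_const.indicator hSs
  rw [hset, ← Measure.restrict_restrict hS', ← lintegral_indicator hS',
    ← lintegral_subtype_comap h0]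
  have step : ∀ z : ({0}ᶜ : Set E),
      {z : E | ‖z‖⁻¹ • z ∈ S}.indicator (fun z => φ ‖z‖) (z : E) =
      (fun y : sphere (0 : E) 1 × Set.Ioi (0 : ℝ) =>
        (Subtype.val ⁻¹' S : Set (sphere (0 : E) 1)).indicator (fun _ => (1 : ℝ≥0∞)) y.1 * φ y.2)
      (homeomorphUnitSphereProd E z) := by
    intro z
    by_cases hz : ‖(z : E)‖⁻¹ • (z : E) ∈ S
    · simp [Set.indicator, hz]
    · simp [Set.indicator, hz]
  have hpow : Measurable fun r : Set.Ioi (0 : ℝ) => ENNReal.ofReal (r.1 ^ (n - 1)) :=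
    ENNReal.measurable_ofReal.comp (measurable_subtype_coe.pow_const _)
  have hprod : Measurable fun y : sphere (0 : E) 1 × Set.Ioi (0 : ℝ) =>
      (Subtype.val ⁻¹' S : Set (sphere (0 : E) 1)).indicator (fun _ => (1 : ℝ≥0∞)) y.1 * φ y.2 :=
    (hind.comp measurable_fst).mul (hφ'.comp measurable_snd)
  rw [lintegral_congr step, hpres.lintegral_comp hprod,
    lintegral_prod_mul hind.aemeasurable hφ'.aemeasurable, lintegral_indicator_const hSs, one_mul,
    Measure.volumeIoiPow, lintegral_withDensity_eq_lintegral_mul _ hpow hφ']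
  congr 1
  rw [← lintegral_subtype_comap measurableSet_Ioi (fun r : ℝ => φ r * ENNReal.ofReal (r ^ (n - 1)))]
  exact lintegral_congr fun r => mul_comm _ _

/-- The integral of the radial density `(1 - r²)^α r^(n-1)` over `(a, 1)`. -/
noncomputable def radialMass (n : ℕ) (α a : ℝ) : ℝ≥0∞ :=
  ∫⁻ r in Set.Ioo a 1, ENNReal.ofReal ((1 - r ^ 2) ^ α) * ENNReal.ofReal (r ^ (n - 1))

theorem setLIntegral_sector {S : Set E} (hS : MeasurableSet S) (α : ℝ) {a : ℝ} (ha : 0 ≤ a) :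
    ∫⁻ z in sector S a, ENNReal.ofReal ((1 - ‖z‖ ^ 2) ^ α) =
      (volume : Measure E).toSphere (Subtype.val ⁻¹' S) * radialMass n α a := by
  have hφ : Measurable fun r : ℝ => ENNReal.ofReal ((1 - r ^ 2) ^ α) :=
    ENNReal.measurable_ofReal.comp ((measurable_const.sub (measurable_id.pow_const 2)).pow_const α)
  have hC := lintegral_cone hS (hφ.indicator (measurableSet_Ioo (a := a) (b := 1)))
  have hsec : sector S a = {z : E | ‖z‖ ∈ Set.Ioo a 1} ∩ {z : E | z ≠ 0 ∧ ‖z‖⁻¹ • z ∈ S} := by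
    ext z
    simp only [sector, Set.mem_ofPred_eq, Set.mem_inter_iff, Set.mem_Ioo]
    tauto
  have hm : MeasurableSet {z : E | ‖z‖ ∈ Set.Ioo a 1} := measurable_norm measurableSet_Ioo
  rw [hsec, ← Measure.restrict_restrict hm, ← lintegral_indicator hm]
  refine Eq.trans ?_ (hC.trans ?_)
  · rfl
  · congr 1
    rw [radialMass]
    have hI : Set.Ioo a 1 = Set.Ioo a 1 ∩ Set.Ioi 0 := by
      ext r
      simp only [Set.mem_Ioo, Set.mem_inter_iff, Set.mem_Ioi]
      exact ⟨fun h => ⟨h, ha.trans_lt h.1⟩, fun h => h.1⟩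
    rw [hI, ← Measure.restrict_restrict measurableSet_Ioo, ← lintegral_indicator measurableSet_Ioo,
      ← hI]
    refine lintegral_congr fun r => ?_
    by_cases hr : r ∈ Set.Ioo a 1 <;> simp [Set.indicator, hr]

theorem volume_sector {S : Set E} (hS : MeasurableSet S) {a : ℝ} (ha : 0 ≤ a) :
    volume (sector S a) =
      (volume : Measure E).toSphere (Subtype.val ⁻¹' S) * radialMass n 0 a := by
  rw [← setLIntegral_sector hS 0 ha]
  simp

theorem setLIntegral_one_sub_rpow {α ρ : ℝ} (hα : -1 < α) (hρ : 0 ≤ ρ) :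
    ∫⁻ r in Set.Ioo (1 - ρ) 1, ENNReal.ofReal ((1 - r) ^ α) =
      ENNReal.ofReal (ρ ^ (α + 1) / (α + 1)) := by
  rw [← setLIntegral_Ioo_rpow hα hρ, ← lintegral_indicator measurableSet_Ioo,
    ← lintegral_indicator measurableSet_Ioo,
    ← lintegral_sub_left_eq_self ((Set.Ioo 0 ρ).indicator fun u => ENNReal.ofReal (u ^ α)) (1 : ℝ)]
  refine lintegral_congr fun r => ?_
  have : r ∈ Set.Ioo (1 - ρ) 1 ↔ 1 - r ∈ Set.Ioo 0 ρ := by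
    simp only [Set.mem_Ioo]
    constructor <;> rintro ⟨h1, h2⟩ <;> constructor <;> linarith
  by_cases hr : r ∈ Set.Ioo (1 - ρ) 1
  · rw [Set.indicator_of_mem hr, Set.indicator_of_mem (this.1 hr)]
  · rw [Set.indicator_of_notMem hr, Set.indicator_of_notMem (fun h => hr (this.2 h))]

theorem one_sub_sq_rpow_bounds (α : ℝ) {r : ℝ} (h0 : 0 < r) (h1 : r < 1) :
    (2 : ℝ) ^ (-|α|) * (1 - r) ^ α ≤ (1 - r ^ 2) ^ α ∧
      (1 - r ^ 2) ^ α ≤ (2 : ℝ) ^ |α| * (1 - r) ^ α := by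
  have hfac : (1 - r ^ 2) ^ α = (1 + r) ^ α * (1 - r) ^ α := by
    rw [← Real.mul_rpow (by linarith) (by linarith)]
    congr 1; ring
  have hpos : 0 ≤ (1 - r) ^ α := Real.rpow_nonneg (by linarith) _
  have hup : (1 + r) ^ |α| ≤ 2 ^ |α| :=
    Real.rpow_le_rpow (by linarith) (by linarith) (abs_nonneg _)
  have hlow : (2 : ℝ) ^ (-|α|) ≤ (1 + r) ^ (-|α|) := by
    rw [Real.rpow_neg (by norm_num), Real.rpow_neg (by linarith)]
    exact inv_anti₀ (Real.rpow_pos_of_pos (by linarith) _) hup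
  rw [hfac]
  constructor
  · refine mul_le_mul_of_nonneg_right (hlow.trans ?_) hpos
    exact Real.rpow_le_rpow_of_exponent_le (by linarith) (neg_abs_le α)
  · refine mul_le_mul_of_nonneg_right (le_trans ?_ hup) hpos
    exact Real.rpow_le_rpow_of_exponent_le (by linarith) (le_abs_self α)

/-- The shell of thickness `ρ` next to the unit sphere has radial mass comparable to
`ρ ^ (α + 1)`. -/
theorem radialMass_bounds (n : ℕ) {α : ℝ} (hα : -1 < α) :
    ∃ c C : ℝ, 0 < c ∧ 0 < C ∧ ∀ ρ, 0 < ρ → ρ ≤ 1 →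
      ENNReal.ofReal (c * ρ ^ (α + 1)) ≤ radialMass n α (1 - ρ) ∧
      radialMass n α (1 - ρ) ≤ ENNReal.ofReal (C * ρ ^ (α + 1)) := by
  have hα1 : 0 < α + 1 := by linarith
  have hm : Measurable fun r : ℝ => ENNReal.ofReal ((1 - r) ^ α) :=
    ENNReal.measurable_ofReal.comp ((measurable_const.sub measurable_id).pow_const α)
  refine ⟨(1 / 2) ^ (n - 1) * 2 ^ (-|α|) * ((1 / 2) ^ (α + 1) / (α + 1)), 2 ^ |α| / (α + 1),
    by positivity, by positivity, fun ρ hρ hρ1 => ⟨?_, ?_⟩⟩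
  · calc ENNReal.ofReal ((1 / 2) ^ (n - 1) * 2 ^ (-|α|) * ((1 / 2) ^ (α + 1) / (α + 1)) *
          ρ ^ (α + 1))
        = ENNReal.ofReal ((1 / 2) ^ (n - 1) * 2 ^ (-|α|)) *
          ENNReal.ofReal ((ρ / 2) ^ (α + 1) / (α + 1)) := by
          rw [← ENNReal.ofReal_mul (by positivity), div_eq_mul_one_div ρ 2,
            Real.mul_rpow hρ.le (by norm_num)]
          congr 1; ring
      _ = ∫⁻ r in Set.Ioo (1 - ρ / 2) 1, ENNReal.ofReal ((1 / 2) ^ (n - 1) * 2 ^ (-|α|)) *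
            ENNReal.ofReal ((1 - r) ^ α) := by
          rw [lintegral_const_mul _ hm, setLIntegral_one_sub_rpow hα (by linarith)]
      _ ≤ ∫⁻ r in Set.Ioo (1 - ρ / 2) 1,
            ENNReal.ofReal ((1 - r ^ 2) ^ α) * ENNReal.ofReal (r ^ (n - 1)) := by
          refine setLIntegral_mono' measurableSet_Ioo fun r hr => ?_
          have hr0 : 1 / 2 ≤ r := by linarith [hr.1]
          have hr1 : r < 1 := hr.2
          rw [← ENNReal.ofReal_mul (by positivity), ← ENNReal.ofReal_mul
            (Real.rpow_nonneg (by nlinarith) _)]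
          refine ENNReal.ofReal_le_ofReal ?_
          rw [mul_assoc, mul_comm]
          refine mul_le_mul (one_sub_sq_rpow_bounds α (by linarith) hr1).1
            (pow_le_pow_left₀ (by norm_num) hr0 _) (by positivity)
            (Real.rpow_nonneg (by nlinarith) _)
      _ ≤ radialMass n α (1 - ρ) :=
          lintegral_mono_set (Set.Ioo_subset_Ioo (by linarith) le_rfl)
  · calc radialMass n α (1 - ρ) ≤ ∫⁻ r in Set.Ioo (1 - ρ) 1, ENNReal.ofReal (2 ^ |α|) *
            ENNReal.ofReal ((1 - r) ^ α) := by
          refine setLIntegral_mono' measurableSet_Ioo fun r hr => ?_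
          have hr0 : 0 < r := by linarith [hr.1]
          have hr1 : r < 1 := hr.2
          have hp : 0 ≤ (1 - r ^ 2) ^ α := Real.rpow_nonneg (by nlinarith) _
          rw [← ENNReal.ofReal_mul hp, ← ENNReal.ofReal_mul (by positivity)]
          refine ENNReal.ofReal_le_ofReal ?_
          exact (mul_le_of_le_one_right hp (pow_le_one₀ hr0.le hr1.le)).trans
            (one_sub_sq_rpow_bounds α hr0 hr1).2
      _ = ENNReal.ofReal (2 ^ |α| / (α + 1) * ρ ^ (α + 1)) := by
          rw [lintegral_const_mul _ hm, setLIntegral_one_sub_rpow hα hρ.le,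
            ← ENNReal.ofReal_mul (by positivity)]
          congr 1; ring

theorem measurableSet_sphereBall (x : E) (s : ℝ) : MeasurableSet (sphereBall x s) :=
  (isClosed_sphere.measurableSet).inter measurableSet_ball

theorem ball_subset_sector {x : E} (hx : x ∈ sphere (0 : E) 1) {s : ℝ} (hs1 : s ≤ 1) :
    ball ((1 - s / 4) • x) (s / 4) ⊆ sector (sphereBall x s) (1 - s) := by
  have hx : ‖x‖ = 1 := by simpa using hx
  intro z hz
  have hz : ‖z - (1 - s / 4) • x‖ < s / 4 := by simpa [dist_eq_norm] using hz
  have hcx : ‖(1 - s / 4) • x‖ = 1 - s / 4 := by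
    rw [norm_smul, hx, mul_one, Real.norm_of_nonneg (by linarith)]
  have h1 : ‖z‖ < 1 := by
    have := norm_le_norm_add_norm_sub' z ((1 - s / 4) • x)
    linarith
  have h2 : 1 - s / 2 < ‖z‖ := by
    have := norm_le_norm_add_norm_sub ((1 - s / 4) • x) z
    rw [norm_sub_rev] at this
    have := norm_sub_norm_le ((1 - s / 4) • x) z
    rw [norm_sub_rev] at this
    linarith
  have hz0 : ‖z‖ ≠ 0 := by intro h; rw [h] at h2; linarith
  have hzz : z ≠ 0 := fun h => hz0 (by simp [h])
  refine ⟨hzz, ⟨by simp [norm_smul, hz0], ?_⟩, by linarith, h1⟩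
  rw [dist_eq_norm]
  have e1 : ‖‖z‖⁻¹ • z - z‖ = 1 - ‖z‖ := by
    have : ‖z‖⁻¹ • z - z = (‖z‖⁻¹ - 1) • z := by rw [sub_smul, one_smul]
    rw [this, norm_smul, Real.norm_of_nonneg, sub_mul, inv_mul_cancel₀ hz0, one_mul]
    rw [sub_nonneg]; exact (one_le_inv₀ (by positivity)).2 h1.le
  have e2 : ‖(1 - s / 4) • x - x‖ = s / 4 := by
    have : (1 - s / 4) • x - x = (-(s / 4)) • x := by rw [sub_smul, one_smul, neg_smul]; abel
    rw [this, norm_smul, hx, mul_one, norm_neg, Real.norm_of_nonneg (by linarith)]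
  calc ‖‖z‖⁻¹ • z - x‖ = ‖(‖z‖⁻¹ • z - z) + (z - (1 - s / 4) • x) + ((1 - s / 4) • x - x)‖ := by
        congr 1; abel
    _ ≤ ‖‖z‖⁻¹ • z - z‖ + ‖z - (1 - s / 4) • x‖ + ‖(1 - s / 4) • x - x‖ := norm_add₃_le
    _ < s := by rw [e1, e2]; linarith

theorem sector_subset_ball {x : E} {s : ℝ} :
    sector (sphereBall x s) (1 - s) ⊆ ball x (2 * s) := by
  rintro z ⟨hz, ⟨-, hd⟩, h1, h2⟩
  have hz0 : ‖z‖ ≠ 0 := by simpa using hz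
  rw [mem_ball]
  have e1 : dist z (‖z‖⁻¹ • z) = 1 - ‖z‖ := by
    rw [dist_eq_norm', ]
    have : ‖z‖⁻¹ • z - z = (‖z‖⁻¹ - 1) • z := by rw [sub_smul, one_smul]
    rw [this, norm_smul, Real.norm_of_nonneg, sub_mul, inv_mul_cancel₀ hz0, one_mul]
    rw [sub_nonneg]; exact (one_le_inv₀ (by positivity)).2 h2.le
  calc dist z x ≤ dist z (‖z‖⁻¹ • z) + dist (‖z‖⁻¹ • z) x := dist_triangle _ _ _
    _ < 2 * s := by rw [e1]; linarith

/-- A cap of radius `s` has surface measure comparable to `s ^ (n - 1)`: the sector of height `s`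
above it contains, and is contained in, a Euclidean ball of radius comparable to `s`. -/
theorem toSphere_sphereBall_bounds (hn : 1 ≤ n) :
    ∃ c C : ℝ, 0 < c ∧ 0 < C ∧ ∀ x ∈ sphere (0 : E) 1, ∀ s, 0 < s → s ≤ 1 →
      ENNReal.ofReal (c * s ^ (n - 1)) ≤
        (volume : Measure E).toSphere (Subtype.val ⁻¹' sphereBall x s) ∧
      (volume : Measure E).toSphere (Subtype.val ⁻¹' sphereBall x s) ≤
        ENNReal.ofReal (C * s ^ (n - 1)) := by
  -- For `α = 0` the radial mass gives Lebesgue measure.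
  obtain ⟨c, C, hc, hC, hb⟩ := radialMass_bounds n (α := 0) (by norm_num)
  have : Nonempty (Fin n) := ⟨⟨0, hn⟩⟩
  set V := (volume (ball (0 : E) 1)).toReal with hV
  have hVt : volume (ball (0 : E) 1) ≠ ∞ := measure_ball_lt_top.ne
  have hV0 : 0 < V := ENNReal.toReal_pos (measure_ball_pos _ _ one_pos).ne' hVt
  have hball : ∀ (y : E) (r : ℝ), 0 ≤ r → volume (ball y r) = ENNReal.ofReal (r ^ n * V) := by
    intro y r hr
    rw [Measure.addHaar_ball _ _ hr, finrank_euclideanSpace_fin, ENNReal.ofReal_mul (by positivity),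
      hV, ENNReal.ofReal_toReal hVt]
  refine ⟨(1 / 4) ^ n * V / C, 2 ^ n * V / c, by positivity, by positivity,
    fun x hx s hs hs1 => ?_⟩
  have hvol := volume_sector (measurableSet_sphereBall x s) (a := 1 - s) (by linarith)
  obtain ⟨hlo, hhi⟩ := hb s hs hs1
  rw [zero_add, Real.rpow_one] at hlo hhi
  set σ := (volume : Measure E).toSphere (Subtype.val ⁻¹' sphereBall x s)
  have hsn : s ^ n = s ^ (n - 1) * s := by rw [← pow_succ, Nat.sub_add_cancel hn]
  constructor
  · have h1 : ENNReal.ofReal ((s / 4) ^ n * V) ≤ σ * ENNReal.ofReal (C * s) := by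
      rw [← hball ((1 - s / 4) • x) _ (by linarith)]
      calc _ ≤ volume (sector (sphereBall x s) (1 - s)) :=
            measure_mono (ball_subset_sector hx hs1)
        _ ≤ _ := by rw [hvol]; gcongr
    rw [← ENNReal.div_le_iff_le_mul (by left; simpa using by positivity) (by simp),
      ← ENNReal.ofReal_div_of_pos (by positivity)] at h1
    refine le_trans (ENNReal.ofReal_le_ofReal (le_of_eq ?_)) h1
    rw [div_pow s, hsn, div_pow, one_pow]
    field_simp
  · have h1 : σ * ENNReal.ofReal (c * s) ≤ ENNReal.ofReal ((2 * s) ^ n * V) := by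
      rw [← hball x _ (by linarith)]
      calc _ ≤ volume (sector (sphereBall x s) (1 - s)) := by rw [hvol]; gcongr
        _ ≤ _ := measure_mono sector_subset_ball
    rw [← ENNReal.le_div_iff_mul_le (by left; simpa using by positivity) (by simp),
      ← ENNReal.ofReal_div_of_pos (by positivity)] at h1
    refine h1.trans (ENNReal.ofReal_le_ofReal (le_of_eq ?_))
    rw [mul_pow, hsn]
    field_simp

end PolarCoordinates

/-! ### The measure of Carleson boxes -/

section BoxMeasure

variable {n : ℕ}

local notation "E" => EuclideanSpace ℝ (Fin n)

/-- The total normalizing factor in the density of `nu n α` with respect to Lebesgue measure. -/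
noncomputable def densityConst (n : ℕ) (α : ℝ) : ℝ≥0∞ :=
  normConst n α * (volume (ball (0 : EuclideanSpace ℝ (Fin n)) 1))⁻¹

theorem nu_apply (α : ℝ) {s : Set E} (hs : MeasurableSet s) :
    nu n α s = densityConst n α * ∫⁻ z in s ∩ ball 0 1, ENNReal.ofReal ((1 - ‖z‖ ^ 2) ^ α) := by
  rw [nu, Measure.smul_apply, withDensity_apply _ hs, ballMeasure, Measure.restrict_smul,
    lintegral_smul_measure, Measure.restrict_restrict hs, smul_eq_mul, smul_eq_mul, densityConst,
    mul_assoc]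

theorem nu_sector {S : Set E} (hS : MeasurableSet S) (α : ℝ) {a : ℝ} (ha : 0 ≤ a) :
    nu n α (sector S a) = densityConst n α *
      ((volume : Measure E).toSphere (Subtype.val ⁻¹' S) * radialMass n α a) := by
  rw [nu_apply α (measurableSet_sector hS a), ← setLIntegral_sector hS α ha,
    Set.inter_eq_self_of_subset_left]
  intro z hz
  simpa using hz.2.2.2

theorem sector_sphere_zero : sector (sphere (0 : E) 1) 0 = ball 0 1 \ {0} := by
  ext z
  simp only [sector, Set.mem_ofPred_eq, mem_sphere_iff_norm, sub_zero, norm_smul, norm_inv,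
    norm_norm, norm_pos_iff, Set.mem_sdiff, mem_ball_zero_iff, Set.mem_singleton_iff]
  constructor
  · rintro ⟨h, -, -, h1⟩
    exact ⟨h1, h⟩
  · rintro ⟨h1, h⟩
    exact ⟨h, inv_mul_cancel₀ (by simpa using h), h, h1⟩

theorem setLIntegral_ball (hn : 1 ≤ n) (α : ℝ) :
    ∫⁻ z in ball (0 : E) 1, ENNReal.ofReal ((1 - ‖z‖ ^ 2) ^ α) =
      (volume : Measure E).toSphere Set.univ * radialMass n α 0 := by
  have : Nonempty (Fin n) := ⟨⟨0, hn⟩⟩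
  have hu : (Set.univ : Set (sphere (0 : E) 1)) = Subtype.val ⁻¹' sphere (0 : E) 1 := by
    ext x; simp
  rw [hu, ← setLIntegral_sector isClosed_sphere.measurableSet α le_rfl, sector_sphere_zero]
  refine setLIntegral_congr ?_
  exact (sdiff_null_ae_eq_self (measure_singleton _)).symm

theorem densityConst_ne (hn : 1 ≤ n) {α : ℝ} (hα : -1 < α) :
    densityConst n α ≠ 0 ∧ densityConst n α ≠ ∞ := by
  have : Nonempty (Fin n) := ⟨⟨0, hn⟩⟩
  obtain ⟨c, C, hc, hC, hb⟩ := radialMass_bounds n hα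
  obtain ⟨h1, h2⟩ := hb 1 one_pos le_rfl
  rw [sub_self, Real.one_rpow, mul_one] at h1 h2
  have hr0 : radialMass n α 0 ≠ 0 := ((ENNReal.ofReal_pos.2 hc).trans_le h1).ne'
  have hrt : radialMass n α 0 ≠ ∞ := ne_top_of_le_ne_top ENNReal.ofReal_ne_top h2
  have hv0 : volume (ball (0 : E) 1) ≠ 0 := (measure_ball_pos _ _ one_pos).ne'
  have hvt : volume (ball (0 : E) 1) ≠ ∞ := measure_ball_lt_top.ne
  have hs0 : (volume : Measure E).toSphere Set.univ ≠ 0 := by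
    rw [Measure.toSphere_apply_univ, finrank_euclideanSpace_fin]
    exact mul_ne_zero (by exact_mod_cast (by omega : n ≠ 0)) hv0
  have hst : (volume : Measure E).toSphere Set.univ ≠ ∞ := measure_ne_top _ _
  rw [densityConst, normConst, ballMeasure, lintegral_smul_measure, setLIntegral_ball hn,
    smul_eq_mul]
  constructor
  · exact mul_ne_zero (ENNReal.inv_ne_zero.2 (ENNReal.mul_ne_top (ENNReal.inv_ne_top.2 hv0)
      (ENNReal.mul_ne_top hst hrt))) (ENNReal.inv_ne_zero.2 hvt)
  · exact ENNReal.mul_ne_top (ENNReal.inv_ne_top.2 (mul_ne_zero (ENNReal.inv_ne_zero.2 hvt)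
      (mul_ne_zero hs0 hr0))) (ENNReal.inv_ne_top.2 hv0)

theorem isFiniteMeasure_nu (hn : 1 ≤ n) {α : ℝ} (hα : -1 < α) : IsFiniteMeasure (nu n α) := by
  obtain ⟨c, C, hc, hC, hb⟩ := radialMass_bounds n hα
  have h2 := (hb 1 one_pos le_rfl).2
  rw [sub_self] at h2
  refine ⟨?_⟩
  rw [nu_apply α MeasurableSet.univ, Set.univ_inter, setLIntegral_ball hn]
  exact (ENNReal.mul_ne_top (densityConst_ne hn hα).2 (ENNReal.mul_ne_top (measure_ne_top _ _)
    (ne_top_of_le_ne_top ENNReal.ofReal_ne_top h2))).lt_top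

theorem ae_nu_mem (hn : 1 ≤ n) (α : ℝ) : ∀ᵐ z ∂(nu n α), z ∈ sector (sphere (0 : E) 1) 0 := by
  have : Nonempty (Fin n) := ⟨⟨0, hn⟩⟩
  have hm : MeasurableSet (sector (sphere (0 : E) 1) 0) :=
    measurableSet_sector isClosed_sphere.measurableSet 0
  rw [ae_iff]
  change nu n α (sector (sphere (0 : E) 1) 0)ᶜ = 0
  rw [nu_apply α hm.compl, sector_sphere_zero]
  have hz : ((ball (0 : E) 1 \ {0})ᶜ ∩ ball 0 1) ⊆ {0} := by
    rintro z ⟨h1, h2⟩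
    by_contra h
    exact h1 ⟨h2, h⟩
  rw [setLIntegral_measure_zero _ _ (measure_mono_null hz (measure_singleton _)), mul_zero]

theorem diam_sphereBall_le (x : E) {s : ℝ} (hs : 0 ≤ s) : diam (sphereBall x s) ≤ 2 * s :=
  (diam_mono (fun _ hy => hy.2) isBounded_ball).trans (diam_ball hs)

theorem isBounded_sphereBall (x : E) (s : ℝ) : Bornology.IsBounded (sphereBall x s) :=
  isBounded_ball.subset fun _ hy => mem_ball.2 hy.2

/-- The sphere is connected, so every distance in `(0, 2)` from `x` is attained on it. This is where
`2 ≤ n` is needed. -/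
theorem min_le_diam_sphereBall (hn : 2 ≤ n) {x : E} (hx : x ∈ sphere (0 : E) 1) {s : ℝ}
    (hs : 0 < s) : min s 2 ≤ diam (sphereBall x s) := by
  refine le_of_forall_lt fun d hd => ?_
  obtain ⟨e, hde, he⟩ := exists_between (max_lt hd (lt_min hs two_pos : (0 : ℝ) < min s 2))
  have he0 : 0 < e := (le_max_right _ _).trans_lt hde
  have hes : e < s := he.trans_le (min_le_left _ _)
  have he2 : e < 2 := he.trans_le (min_le_right _ _)
  have hrank : 1 < Module.rank ℝ E := by
    rw [← Module.finrank_eq_rank, finrank_euclideanSpace_fin]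
    exact_mod_cast (by omega : 1 < n)
  have hx' : -x ∈ sphere (0 : E) 1 := by simpa using hx
  have hxn : ‖x‖ = 1 := by simpa using hx
  have hival := (isPreconnected_sphere hrank (0 : E) 1).intermediate_value hx hx'
    (f := fun y => dist y x) (continuous_id.dist continuous_const).continuousOn
  have hdist : dist (-x) x = 2 := by
    rw [dist_eq_norm, ← neg_add', norm_neg, ← two_smul ℝ x, norm_smul, hxn]; norm_num
  have hmem : e ∈ Set.Icc (dist x x) (dist (-x) x) := by
    rw [hdist, dist_self]; exact ⟨he0.le, he2.le⟩
  obtain ⟨y, hy, hyx⟩ := hival hmem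
  have hyx : dist y x = e := hyx
  calc d ≤ max d 0 := le_max_left _ _
    _ < e := hde
    _ = dist y x := hyx.symm
    _ ≤ diam (sphereBall x s) := dist_le_diam_of_mem (isBounded_sphereBall x s)
        ⟨hy, by rw [hyx]; exact hes⟩ ⟨hx, by rw [dist_self]; exact hs⟩

theorem carlesonBox_eq_sector (x : E) (s : ℝ) :
    carlesonBox (sphereBall x s) =
      sector (sphereBall x s) (1 - diam (sphereBall x s) / 2) := by
  ext z
  constructor
  · rintro ⟨-, hd, h1, h2⟩
    refine ⟨?_, hd, h1, h2⟩
    rintro rfl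
    simpa using hd.1
  · rintro ⟨-, hd, h1, h2⟩
    exact ⟨by simpa using h2, hd, h1, h2⟩

theorem measurableSet_carlesonBox (x : E) (s : ℝ) :
    MeasurableSet (carlesonBox (sphereBall x s)) := by
  rw [carlesonBox_eq_sector]
  exact measurableSet_sector (measurableSet_sphereBall x s) _

theorem sector_mono {S S' : Set E} {a a' : ℝ} (hS : S ⊆ S') (ha : a' ≤ a) :
    sector S a ⊆ sector S' a' :=
  fun _ ⟨h0, hd, h1, h2⟩ => ⟨h0, hS hd, ha.trans_lt h1, h2⟩

theorem sphereBall_mono (x : E) {s s' : ℝ} (h : s ≤ s') : sphereBall x s ⊆ sphereBall x s' :=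
  fun _ hy => ⟨hy.1, hy.2.trans_le h⟩

/-- With `t = min s 1`, the box above a cap of radius `s` has measure comparable to
`t ^ (n - 1) * t ^ (α + 1)`. -/
theorem nu_carlesonBox_bounds (hn : 2 ≤ n) {α : ℝ} (hα : -1 < α) :
    ∃ c C : ℝ, 0 < c ∧ 0 < C ∧ ∀ x ∈ sphere (0 : E) 1, ∀ s, 0 < s →
      ENNReal.ofReal (c * (min s 1 ^ (n - 1) * min s 1 ^ (α + 1))) ≤
        nu n α (carlesonBox (sphereBall x s)) ∧
      nu n α (carlesonBox (sphereBall x s)) ≤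
        ENNReal.ofReal (C * (min s 1 ^ (n - 1) * min s 1 ^ (α + 1))) := by
  have hn1 : 1 ≤ n := by omega
  have := isFiniteMeasure_nu hn1 hα
  obtain ⟨hd0, hdt⟩ := densityConst_ne hn1 hα
  obtain ⟨c, C, hc, hC, hb⟩ := radialMass_bounds n hα
  obtain ⟨c', C', hc', hC', hb'⟩ := toSphere_sphereBall_bounds hn1
  set β := (densityConst n α).toReal with hβ
  have hβ0 : 0 < β := ENNReal.toReal_pos hd0 hdt
  have hdβ : densityConst n α = ENNReal.ofReal β := (ENNReal.ofReal_toReal hdt).symm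
  refine ⟨β * c' * (c * (1 / 2) ^ (α + 1)), β * C' * C + (nu n α Set.univ).toReal,
    by positivity, by positivity, fun x hx s hs => ⟨?_, ?_⟩⟩
  · set t := min s 1 with ht
    have ht0 : 0 < t := lt_min hs one_pos
    have ht1 : t ≤ 1 := min_le_right _ _
    calc ENNReal.ofReal (β * c' * (c * (1 / 2) ^ (α + 1)) * (t ^ (n - 1) * t ^ (α + 1)))
        = ENNReal.ofReal β * (ENNReal.ofReal (c' * t ^ (n - 1)) *
            ENNReal.ofReal (c * (t / 2) ^ (α + 1))) := by
          rw [← ENNReal.ofReal_mul (by positivity), ← ENNReal.ofReal_mul (by positivity),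
            div_eq_mul_one_div t 2, Real.mul_rpow ht0.le (by norm_num)]
          congr 1; ring
      _ ≤ densityConst n α * ((volume : Measure E).toSphere (Subtype.val ⁻¹' sphereBall x t) *
            radialMass n α (1 - t / 2)) := by
          rw [hdβ]
          gcongr
          · exact (hb' x hx t ht0 ht1).1
          · exact (hb (t / 2) (by positivity) (by linarith)).1
      _ = nu n α (sector (sphereBall x t) (1 - t / 2)) :=
          (nu_sector (measurableSet_sphereBall x t) α (by linarith)).symm
      _ ≤ nu n α (carlesonBox (sphereBall x s)) := by
          rw [carlesonBox_eq_sector]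
          refine measure_mono (sector_mono (sphereBall_mono x (min_le_left _ _)) ?_)
          have h1 := min_le_diam_sphereBall hn hx hs
          have h2 : t ≤ min s 2 := min_le_min_left _ (by norm_num)
          linarith
  · rcases le_or_gt s 1 with hs1 | hs1
    · rw [min_eq_left hs1]
      calc nu n α (carlesonBox (sphereBall x s))
          ≤ nu n α (sector (sphereBall x s) (1 - s)) := by
            rw [carlesonBox_eq_sector]
            refine measure_mono (sector_mono le_rfl ?_)
            linarith [diam_sphereBall_le x hs.le]
        _ = densityConst n α * ((volume : Measure E).toSphere (Subtype.val ⁻¹' sphereBall x s) *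
              radialMass n α (1 - s)) :=
            nu_sector (measurableSet_sphereBall x s) α (by linarith)
        _ ≤ ENNReal.ofReal β * (ENNReal.ofReal (C' * s ^ (n - 1)) *
              ENNReal.ofReal (C * s ^ (α + 1))) := by
            rw [hdβ]
            gcongr
            · exact (hb' x hx s hs hs1).2
            · exact (hb s hs hs1).2
        _ = ENNReal.ofReal (β * C' * C * (s ^ (n - 1) * s ^ (α + 1))) := by
            rw [← ENNReal.ofReal_mul (by positivity), ← ENNReal.ofReal_mul (by positivity)]
            congr 1; ring
        _ ≤ _ := by
            refine ENNReal.ofReal_le_ofReal (mul_le_mul_of_nonneg_right ?_ (by positivity))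
            linarith [ENNReal.toReal_nonneg (a := nu n α Set.univ)]
    · rw [min_eq_right hs1.le, one_pow, Real.one_rpow, mul_one, mul_one]
      calc nu n α (carlesonBox (sphereBall x s)) ≤ nu n α Set.univ :=
            measure_mono (Set.subset_univ _)
        _ = ENNReal.ofReal (nu n α Set.univ).toReal :=
            (ENNReal.ofReal_toReal (measure_ne_top _ _)).symm
        _ ≤ _ := ENNReal.ofReal_le_ofReal (le_add_of_nonneg_left (by positivity))

theorem nu_carlesonBox_pos (hn : 2 ≤ n) {α : ℝ} (hα : -1 < α) {x : E}
    (hx : x ∈ sphere (0 : E) 1) {s : ℝ} (hs : 0 < s) :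
    nu n α (carlesonBox (sphereBall x s)) ≠ 0 := by
  obtain ⟨c, C, hc, hC, hb⟩ := nu_carlesonBox_bounds hn hα
  have : 0 < min s 1 := lt_min hs one_pos
  exact ((ENNReal.ofReal_pos.2 (by positivity)).trans_le (hb x hx s hs).1).ne'

theorem nu_carlesonBox_doubling (hn : 2 ≤ n) {α : ℝ} (hα : -1 < α) {K : ℝ} (hK : 1 ≤ K) :
    ∃ D : ℝ≥0, ∀ x ∈ sphere (0 : E) 1, ∀ x' ∈ sphere (0 : E) 1, ∀ s, 0 < s →
      ∀ s', 0 < s' → s' ≤ K * s →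
      nu n α (carlesonBox (sphereBall x' s')) ≤ D * nu n α (carlesonBox (sphereBall x s)) := by
  obtain ⟨c, C, hc, hC, hb⟩ := nu_carlesonBox_bounds hn hα
  have hK0 : 0 < K := by linarith
  refine ⟨(C / c * (K ^ (n - 1) * K ^ (α + 1))).toNNReal, fun x hx x' hx' s hs s' hs' hle => ?_⟩
  set t := min s 1 with ht
  set t' := min s' 1 with ht'
  have ht0 : 0 < t := lt_min hs one_pos
  have ht0' : 0 < t' := lt_min hs' one_pos
  have htt : t' ≤ K * t := by
    rcases le_total s 1 with h | h
    · rw [ht, min_eq_left h]; exact (min_le_left _ _).trans hle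
    · rw [ht, min_eq_right h, mul_one]; exact (min_le_right _ _).trans hK
  calc nu n α (carlesonBox (sphereBall x' s'))
      ≤ ENNReal.ofReal (C * (t' ^ (n - 1) * t' ^ (α + 1))) := (hb x' hx' s' hs').2
    _ ≤ ENNReal.ofReal (C * ((K * t) ^ (n - 1) * (K * t) ^ (α + 1))) := by
        refine ENNReal.ofReal_le_ofReal ?_
        gcongr
        linarith
    _ = ENNReal.ofReal (C / c * (K ^ (n - 1) * K ^ (α + 1))) *
          ENNReal.ofReal (c * (t ^ (n - 1) * t ^ (α + 1))) := by
        rw [← ENNReal.ofReal_mul (by positivity), mul_pow, Real.mul_rpow hK0.le ht0.le]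
        congr 1
        field_simp
    _ ≤ _ := by
        gcongr
        · exact le_rfl
        · exact (hb x hx s hs).1

end BoxMeasure

/-! ### Dyadic cubes and tents -/

section DyadicTents

variable {n : ℕ}

local notation "E" => EuclideanSpace ℝ (Fin n)

/-- The shift `0` or `1 / 2` of a grid in one coordinate direction, in units of the side length. -/
noncomputable def gridShift (b : Bool) : ℝ := cond b (1 / 2) 0

/-- The index of the cube of generation `k` that contains `y`, in the grid shifted by `t`. The cubes
of generation `k` have side `12 · 3⁻ᵏ`. In base three a shift by half a cube is compatible with
refinement, since three halves of a small cube are a half of it modulo whole cubes; so the same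
shift serves for all generations. -/
noncomputable def gridCode (t : Fin n → Bool) (k : ℕ) (y : EuclideanSpace ℝ (Fin n)) :
    Fin n → ℤ :=
  fun i => ⌊3 ^ k * y i / 12 - gridShift (t i)⌋

theorem floor_eq_of_floor_three_mul_add_eq {u v : ℝ} {j : ℤ} (h : ⌊3 * u + j⌋ = ⌊3 * v + j⌋) :
    ⌊u⌋ = ⌊v⌋ := by
  rw [Int.floor_add_intCast, Int.floor_add_intCast, add_left_inj] at h
  have key : ∀ w : ℝ, ⌊w⌋ = ⌊3 * w⌋ / 3 := by
    intro w
    have h1 : 3 * ⌊w⌋ ≤ ⌊3 * w⌋ := by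
      rw [Int.le_floor]; push_cast; linarith [Int.floor_le w]
    have h2 : ⌊3 * w⌋ < 3 * ⌊w⌋ + 3 := by
      rw [Int.floor_lt]; push_cast; linarith [Int.lt_floor_add_one w]
    omega
  rw [key u, key v, h]

theorem gridCode_eq_of_succ {t : Fin n → Bool} {k : ℕ} {y z : E}
    (h : gridCode t (k + 1) y = gridCode t (k + 1) z) : gridCode t k y = gridCode t k z := by
  funext i
  have hi := congrFun h i
  obtain ⟨j, hj⟩ : ∃ j : ℤ, (j : ℝ) = 2 * gridShift (t i) := by
    cases t i
    · exact ⟨0, by simp [gridShift]⟩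
    · exact ⟨1, by simp [gridShift]⟩
  have hw : ∀ w : ℝ, 3 ^ (k + 1) * w / 12 - gridShift (t i) =
      3 * (3 ^ k * w / 12 - gridShift (t i)) + j := by
    intro w; rw [hj, pow_succ]; ring
  simp only [gridCode, hw] at hi
  exact floor_eq_of_floor_three_mul_add_eq hi

theorem gridCode_eq_of_le {t : Fin n → Bool} {k l : ℕ} (hkl : k ≤ l) {y z : E}
    (h : gridCode t l y = gridCode t l z) : gridCode t k y = gridCode t k z := by
  induction l, hkl using Nat.le_induction with
  | base => exact h
  | succ l _ ih => exact ih (gridCode_eq_of_succ h)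

/-- An interval of length `1 / 2` lies in a unit interval of the standard grid or of the grid
shifted by `1 / 2`. -/
theorem exists_shift_floor_eq (c : ℝ) :
    ∃ (b : Bool) (m : ℤ), ∀ y : ℝ, |y - c| < 1 / 4 → ⌊y - gridShift b⌋ = m := by
  have h0 := Int.floor_le c
  have h1 := Int.lt_floor_add_one c
  rcases lt_or_ge c (⌊c⌋ + 1 / 4) with h | h
  · refine ⟨true, ⌊c⌋ - 1, fun y hy => ?_⟩
    rw [abs_lt] at hy
    rw [Int.floor_eq_iff]
    simp only [gridShift, cond_true]
    push_cast
    constructor <;> linarith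
  rcases le_or_gt c (⌊c⌋ + 3 / 4) with h' | h'
  · refine ⟨false, ⌊c⌋, fun y hy => ?_⟩
    rw [abs_lt] at hy
    rw [Int.floor_eq_iff]
    simp only [gridShift, cond_false]
    constructor <;> linarith
  · refine ⟨true, ⌊c⌋, fun y hy => ?_⟩
    rw [abs_lt] at hy
    rw [Int.floor_eq_iff]
    simp only [gridShift, cond_true]
    constructor <;> linarith

theorem measurable_gridCode (t : Fin n → Bool) (k : ℕ) :
    Measurable (gridCode t k : E → Fin n → ℤ) := by
  refine measurable_pi_lambda _ fun i => ?_
  refine Int.measurable_floor.comp ?_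
  fun_prop

/-- The tent above the cube with index `j.2` of generation `j.1`: the points whose radial projection
lies in the cube and whose distance to the sphere is less than a quarter of its side. -/
def tent (t : Fin n → Bool) (j : ℕ × (Fin n → ℤ)) : Set (EuclideanSpace ℝ (Fin n)) :=
  sector {y | gridCode t j.1 y = j.2} (1 - 3 * (1 / 3) ^ j.1)

theorem isDyadicFamily_tent (t : Fin n → Bool) :
    IsDyadicFamily (tent t) (fun j : ℕ × (Fin n → ℤ) => j.1) where
  measurableSet j := measurableSet_sector
    (measurable_gridCode t j.1 (measurableSet_singleton j.2)) _
  nested := by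
    intro i j hij hle
    by_cases hdis : Disjoint (tent t i) (tent t j)
    · exact Or.inl hdis
    right
    obtain ⟨z, hzi, hzj⟩ := Set.not_disjoint_iff.1 hdis
    have hci : gridCode t i.1 (‖z‖⁻¹ • z) = i.2 := hzi.2.1
    have hcj : gridCode t j.1 (‖z‖⁻¹ • z) = j.2 := hzj.2.1
    rcases hle.lt_or_eq with hlt | heq
    · refine ⟨hlt, ?_⟩
      refine sector_mono (fun y hy => ?_) ?_
      · have hy : gridCode t j.1 y = j.2 := hy
        change gridCode t i.1 y = i.2
        rw [← hci]
        exact gridCode_eq_of_le hle (hy.trans hcj.symm)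
      · have : (1 / 3 : ℝ) ^ j.1 ≤ (1 / 3) ^ i.1 :=
          pow_le_pow_of_le_one (by norm_num) (by norm_num) hle
        linarith
    · exact absurd (Prod.ext heq (by rw [← hci, ← hcj, heq])) hij

theorem abs_apply_sub_le_dist (x y : E) (i : Fin n) : |y i - x i| ≤ dist y x := by
  rw [dist_eq_norm]
  exact PiLp.norm_apply_le (y - x) i

theorem dist_lt_of_gridCode_eq (hn : 1 ≤ n) {t : Fin n → Bool} {k : ℕ} {x y : E}
    (h : gridCode t k y = gridCode t k x) : dist y x < 13 * n * (1 / 3) ^ k := by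
  set ε : ℝ := (1 / 3) ^ k with hε
  have hε0 : 0 < ε := by positivity
  have h3 : (3 : ℝ) ^ k * ε = 1 := by rw [hε, ← mul_pow]; norm_num
  have hn' : (1 : ℝ) ≤ n := by exact_mod_cast hn
  have hcoord : ∀ i, dist (y i) (x i) ≤ 12 * ε := by
    intro i
    have hi := Int.abs_sub_lt_one_of_floor_eq_floor (congrFun h i)
    have hi' : |3 ^ k * (y i - x i)| < 12 := by
      have : 3 ^ k * (y i - x i) = 12 * ((3 ^ k * y i / 12 - gridShift (t i)) -
        (3 ^ k * x i / 12 - gridShift (t i))) := by ring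
      rw [this, abs_mul, abs_of_pos (by norm_num : (0 : ℝ) < 12)]
      linarith
    rw [abs_mul, abs_of_pos (by positivity)] at hi'
    rw [Real.dist_eq]
    calc |y i - x i| = (3 ^ k * |y i - x i|) * ε := by
          rw [mul_right_comm, h3, one_mul]
      _ ≤ 12 * ε := by gcongr
  rw [EuclideanSpace.dist_eq, Real.sqrt_lt' (by positivity)]
  calc ∑ i, dist (y i) (x i) ^ 2 ≤ ∑ _i : Fin n, (12 * ε) ^ 2 := by
        gcongr with i
        exact hcoord i
    _ = n * (12 * ε) ^ 2 := by simp
    _ ≤ (12 * n * ε) ^ 2 := by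
        nlinarith [mul_nonneg (sub_nonneg.2 hn') (by positivity : 0 ≤ n * (12 * ε) ^ 2)]
    _ < (13 * n * ε) ^ 2 := by
        gcongr
        norm_num

/-- Every Carleson box is contained in a tent of one of the `2 ^ n` grids, which is contained in a
box of comparable size. -/
theorem exists_tent_between (hn : 2 ≤ n) {x : E} (hx : x ∈ sphere (0 : E) 1) {s : ℝ}
    (hs : 0 < s) : ∃ (t : Fin n → Bool) (j : ℕ × (Fin n → ℤ)) (s' : ℝ), 0 < s' ∧
      s' ≤ 13 * n * s ∧ carlesonBox (sphereBall x s) ⊆ tent t j ∧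
      tent t j ⊆ carlesonBox (sphereBall x s') := by
  -- For `s > 2` the cap is the whole sphere, so that `s` can be replaced by `3`.
  wlog hs3 : s ≤ 3 generalizing s
  · obtain ⟨t, j, s', hs', hle, h1, h2⟩ := this (s := 3) (by norm_num) le_rfl
    refine ⟨t, j, s', hs', hle.trans (by have := not_le.1 hs3; gcongr), ?_, h2⟩
    have heq : sphereBall x s = sphereBall x 3 := by
      refine Set.Subset.antisymm (fun y hy => ⟨hy.1, ?_⟩) (sphereBall_mono x (not_le.1 hs3).le)
      have h1 : dist y 0 = 1 := hy.1
      have h2 : dist x 0 = 1 := hx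
      linarith [dist_triangle_right y x 0]
    rwa [heq]
  -- The generation `k` satisfies `3⁻ᵏ < s ≤ 3 · 3⁻ᵏ`, so that the cap has width at most half
  -- the side of a cube.
  obtain ⟨k, hk1, hk2⟩ := exists_nat_pow_near_of_lt_one (x := s / 3) (y := (1 / 3 : ℝ))
    (by positivity) (by linarith) (by norm_num) (by norm_num)
  set ε : ℝ := (1 / 3) ^ k with hε
  have hε0 : 0 < ε := by positivity
  have hn' : (2 : ℝ) ≤ n := by exact_mod_cast hn
  have h3 : (3 : ℝ) ^ k * ε = 1 := by rw [hε, ← mul_pow]; norm_num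
  have hεs : ε < s := by rw [pow_succ] at hk1; linarith
  have hsε : s ≤ 3 * ε := by linarith
  choose t m htm using fun i : Fin n => exists_shift_floor_eq (3 ^ k * x i / 12)
  have hcode : ∀ y, dist y x < s → gridCode t k y = m := by
    intro y hy
    funext i
    refine htm i _ ?_
    have h1 := (abs_apply_sub_le_dist x y i).trans_lt hy
    have : 3 ^ k * y i / 12 - 3 ^ k * x i / 12 = 3 ^ k / 12 * (y i - x i) := by ring
    rw [this, abs_mul, abs_of_pos (by positivity)]
    calc (3 : ℝ) ^ k / 12 * |y i - x i| < 3 ^ k / 12 * (3 * ε) := by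
          gcongr; exact h1.trans_le hsε
      _ = 1 / 4 := by linear_combination (1 / 4) * h3
  refine ⟨t, (k, m), 13 * n * ε, by positivity, by gcongr, ?_, ?_⟩
  · rw [carlesonBox_eq_sector]
    refine sector_mono (fun y hy => hcode y hy.2) ?_
    have := diam_sphereBall_le x hs.le
    change 1 - 3 * ε ≤ _
    linarith
  · rw [carlesonBox_eq_sector]
    rintro z ⟨hz0, hd, h1, h2⟩
    have hd : gridCode t k (‖z‖⁻¹ • z) = m := hd
    have h1 : 1 - 3 * ε < ‖z‖ := h1
    have hzn : 0 < ‖z‖ := norm_pos_iff.2 hz0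
    refine ⟨hz0, ⟨?_, ?_⟩, ?_, h2⟩
    · simp [norm_smul, hzn.ne']
    · have hxm : gridCode t k x = m := hcode x (by simpa using hs)
      exact dist_lt_of_gridCode_eq (by omega) (hd.trans hxm.symm)
    · have hdiam := min_le_diam_sphereBall hn hx (s := 13 * n * ε) (by positivity)
      rcases min_cases (13 * n * ε) 2 with ⟨h, -⟩ | ⟨h, -⟩
      · rw [h] at hdiam
        nlinarith
      · rw [h] at hdiam
        linarith

end DyadicTents

/-! ### The Rubio de Francia algorithm -/

section RubioDeFrancia

variable {X κ : Type*} [MeasurableSpace X] {μ : Measure X} {T : κ → Set X}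

/-- Jensen's inequality for the weights `2⁻¹, 2⁻², …`, of total mass at most one. -/
theorem sum_range_half_pow_rpow_le {q : ℝ} (hq : 1 ≤ q) (N : ℕ) (a : ℕ → ℝ≥0∞) :
    (∑ k ∈ Finset.range N, 2⁻¹ ^ (k + 1) * a k) ^ q ≤
      ∑ k ∈ Finset.range N, 2⁻¹ ^ (k + 1) * a k ^ q := by
  induction N generalizing a with
  | zero => simp [ENNReal.zero_rpow_of_pos (by linarith : 0 < q)]
  | succ N ih =>
    have hsplit : ∀ b : ℕ → ℝ≥0∞, ∑ k ∈ Finset.range (N + 1), 2⁻¹ ^ (k + 1) * b k =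
        2⁻¹ * b 0 + 2⁻¹ * ∑ k ∈ Finset.range N, 2⁻¹ ^ (k + 1) * b (k + 1) := by
      intro b
      rw [Finset.sum_range_succ', Finset.mul_sum, add_comm]
      congr 1
      · simp
      · refine Finset.sum_congr rfl fun k _ => ?_
        rw [pow_succ' _ (k + 1), mul_assoc]
    rw [hsplit, hsplit fun k => a k ^ q]
    refine (ENNReal.rpow_arith_mean_le_arith_mean2_rpow _ _ _ _
      ENNReal.inv_two_add_inv_two hq).trans ?_
    gcongr
    exact ih fun k => a (k + 1)

theorem tsum_half_pow_rpow_le {q : ℝ} (hq : 1 ≤ q) (a : ℕ → ℝ≥0∞) :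
    (∑' k, 2⁻¹ ^ k * a k) ^ q ≤ 2 ^ q * ∑' k, 2⁻¹ ^ (k + 1) * a k ^ q := by
  have hq0 : 0 < q := by linarith
  have h1 : ∑' k, 2⁻¹ ^ k * a k = 2 * ∑' k, 2⁻¹ ^ (k + 1) * a k := by
    rw [← ENNReal.tsum_mul_left]
    refine tsum_congr fun k => ?_
    rw [pow_succ', ← mul_assoc, ← mul_assoc, ENNReal.mul_inv_cancel two_ne_zero (by simp), one_mul]
  rw [h1, ENNReal.mul_rpow_of_nonneg _ _ hq0.le]
  gcongr
  rw [← ENNReal.le_rpow_inv_iff hq0]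
  refine ENNReal.tsum_le_of_sum_range_le fun N => ?_
  rw [ENNReal.le_rpow_inv_iff hq0]
  exact (sum_range_half_pow_rpow_le hq N a).trans (ENNReal.sum_le_tsum _)

theorem tsum_half_pow_succ_mul (c : ℝ≥0∞) : ∑' k : ℕ, 2⁻¹ ^ (k + 1) * c = c := by
  rw [ENNReal.tsum_mul_right, ENNReal.tsum_geometric_add_one, ENNReal.one_sub_inv_two,
    inv_inv, ENNReal.inv_mul_cancel two_ne_zero (by simp), one_mul]

/-- The Rubio de Francia algorithm: the series `∑ (2Λ)⁻ᵏ Mᵏ U` majorizes `U`, is an `A₁` weight with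
constant `2Λ`, and its norm is at most twice that of `U`. -/
theorem exists_majorant_maximalFn_le [Countable κ] (hT : ∀ i, MeasurableSet (T i))
    {q : ℝ} (hq : 1 ≤ q) {v : X → ℝ≥0∞} (hv : Measurable v) {Λ : ℝ≥0∞} (hΛ0 : Λ ≠ 0) (hΛt : Λ ≠ ∞)
    (hM : ∀ u : X → ℝ≥0∞, Measurable u →
      ∫⁻ x, maximalFn μ T u x ^ q * v x ∂μ ≤ Λ ^ q * ∫⁻ x, u x ^ q * v x ∂μ)
    {U : X → ℝ≥0∞} (hU : Measurable U) :
    ∃ G : X → ℝ≥0∞, Measurable G ∧ (∀ x, U x ≤ G x) ∧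
      (∀ x, maximalFn μ T G x ≤ 2 * Λ * G x) ∧
      ∫⁻ x, G x ^ q * v x ∂μ ≤ 2 ^ q * ∫⁻ x, U x ^ q * v x ∂μ := by
  have hq0 : 0 < q := by linarith
  set W : ℕ → X → ℝ≥0∞ := fun k => (maximalFn μ T)^[k] U with hW
  have hW1 : ∀ k, W (k + 1) = maximalFn μ T (W k) := fun k =>
    Function.iterate_succ_apply' _ _ _
  have hWm : ∀ k, Measurable (W k) := by
    intro k
    cases k with
    | zero => exact hU
    | succ k => rw [hW1]; exact measurable_maximalFn hT _
  have hnorm : ∀ k, ∫⁻ x, W k x ^ q * v x ∂μ ≤ (Λ ^ k) ^ q * ∫⁻ x, U x ^ q * v x ∂μ := by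
    intro k
    induction k with
    | zero => simp [hW]
    | succ k ih =>
      rw [hW1, pow_succ', ENNReal.mul_rpow_of_nonneg _ _ hq0.le, mul_assoc]
      exact (hM _ (hWm k)).trans (by gcongr)
  have h2Λ0 : 2 * Λ ≠ 0 := mul_ne_zero two_ne_zero hΛ0
  have h2Λt : 2 * Λ ≠ ∞ := ENNReal.mul_ne_top (by simp) hΛt
  have hterm : ∀ k, Measurable fun x => (2 * Λ)⁻¹ ^ k * W k x := fun k => (hWm k).const_mul _
  refine ⟨fun x => ∑' k, (2 * Λ)⁻¹ ^ k * W k x, Measurable.tsum hterm, ?_, ?_, ?_⟩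
  · intro x
    refine le_trans (le_of_eq ?_) (ENNReal.le_tsum 0)
    simp [hW]
  · intro x
    calc maximalFn μ T (fun x => ∑' k, (2 * Λ)⁻¹ ^ k * W k x) x
        ≤ ∑' k, maximalFn μ T (fun x => (2 * Λ)⁻¹ ^ k * W k x) x := maximalFn_tsum_le hterm x
      _ ≤ ∑' k, 2 * Λ * ((2 * Λ)⁻¹ ^ (k + 1) * W (k + 1) x) := by
          refine ENNReal.tsum_le_tsum fun k => (maximalFn_const_mul (hWm k) _ x).trans (le_of_eq ?_)
          rw [pow_succ', ← mul_assoc, ← mul_assoc, ENNReal.mul_inv_cancel h2Λ0 h2Λt, one_mul, hW1]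
      _ = 2 * Λ * ∑' k, (2 * Λ)⁻¹ ^ (k + 1) * W (k + 1) x := ENNReal.tsum_mul_left
      _ ≤ _ := by
          gcongr
          exact ENNReal.tsum_comp_le_tsum_of_injective (add_left_injective 1)
            (fun k => (2 * Λ)⁻¹ ^ k * W k x)
  · have hpt : ∀ x, (∑' k, (2 * Λ)⁻¹ ^ k * W k x) ^ q * v x ≤
        2 ^ q * ∑' k, 2⁻¹ ^ (k + 1) * (((Λ⁻¹ ^ k) ^ q) * (W k x ^ q * v x)) := by
      intro x
      have h1 : ∑' k, (2 * Λ)⁻¹ ^ k * W k x = ∑' k, 2⁻¹ ^ k * (Λ⁻¹ ^ k * W k x) := by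
        refine tsum_congr fun k => ?_
        rw [ENNReal.mul_inv (Or.inl two_ne_zero) (Or.inl (by simp)), mul_pow, mul_assoc]
      rw [h1]
      calc _ ≤ (2 ^ q * ∑' k, 2⁻¹ ^ (k + 1) * (Λ⁻¹ ^ k * W k x) ^ q) * v x := by
            gcongr
            exact tsum_half_pow_rpow_le hq _
        _ = _ := by
            rw [mul_assoc, ← ENNReal.tsum_mul_right]
            congr 1
            refine tsum_congr fun k => ?_
            rw [ENNReal.mul_rpow_of_nonneg _ _ hq0.le]
            ring
    have hmk : ∀ k, Measurable fun x => W k x ^ q * v x := fun k => ((hWm k).pow_const q).mul hv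
    calc _ ≤ ∫⁻ x, 2 ^ q * ∑' k, 2⁻¹ ^ (k + 1) * (((Λ⁻¹ ^ k) ^ q) * (W k x ^ q * v x)) ∂μ :=
          lintegral_mono hpt
      _ = 2 ^ q * ∑' k, 2⁻¹ ^ (k + 1) * ((Λ⁻¹ ^ k) ^ q * ∫⁻ x, W k x ^ q * v x ∂μ) := by
          rw [lintegral_const_mul _ (Measurable.tsum fun k =>
            ((hmk k).const_mul _).const_mul _), lintegral_tsum fun k =>
            (((hmk k).const_mul _).const_mul _).aemeasurable]
          congr 1
          refine tsum_congr fun k => ?_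
          rw [lintegral_const_mul _ ((hmk k).const_mul _), lintegral_const_mul _ (hmk k)]
      _ ≤ 2 ^ q * ∑' k : ℕ, 2⁻¹ ^ (k + 1) * ∫⁻ x, U x ^ q * v x ∂μ := by
          gcongr with k
          calc (Λ⁻¹ ^ k) ^ q * ∫⁻ x, W k x ^ q * v x ∂μ
              ≤ (Λ⁻¹ ^ k) ^ q * ((Λ ^ k) ^ q * ∫⁻ x, U x ^ q * v x ∂μ) := by
                gcongr; exact hnorm k
            _ = _ := by
                rw [← mul_assoc, ← ENNReal.mul_rpow_of_nonneg _ _ hq0.le, ← mul_pow,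
                  ENNReal.inv_mul_cancel hΛ0 hΛt, one_pow, ENNReal.one_rpow, one_mul]
      _ = _ := by rw [tsum_half_pow_succ_mul]

theorem average_rpow_mul_rpow_le {s : Set X} (hs0 : μ s ≠ 0) (hst : μ s ≠ ∞) {f g : X → ℝ≥0∞}
    (hf : Measurable f) (hg : Measurable g) {a b : ℝ} (ha : 0 ≤ a) (hb : 0 ≤ b) (hab : a + b = 1) :
    (∫⁻ x in s, f x ^ a * g x ^ b ∂μ) / μ s ≤
      ((∫⁻ x in s, f x ∂μ) / μ s) ^ a * ((∫⁻ x in s, g x ∂μ) / μ s) ^ b := by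
  have h := ENNReal.lintegral_mul_norm_pow_le (μ := μ.restrict s) hf.aemeasurable hg.aemeasurable
    ha hb hab
  rw [ENNReal.div_rpow_of_nonneg _ _ ha, ENNReal.div_rpow_of_nonneg _ _ hb]
  calc _ ≤ ((∫⁻ x in s, f x ∂μ) ^ a * (∫⁻ x in s, g x ∂μ) ^ b) / μ s := by gcongr
    _ = _ := by
        rw [div_eq_mul_inv, div_eq_mul_inv, div_eq_mul_inv, ← ENNReal.rpow_neg, ← ENNReal.rpow_neg]
        have : (μ s)⁻¹ = μ s ^ (-a) * μ s ^ (-b) := by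
          rw [← ENNReal.rpow_add _ _ hs0 hst, ← ENNReal.rpow_neg_one]
          congr 1; linarith
        rw [this]; ring

/-- If the average of `G` is at most `K G` on `s`, and `w` has `A_p` quantity at most `A` on `s`,
then the interpolated weight `G ^ ((p-2)/(p-1)) * w ^ (1/(p-1))` has `A₂` quantity at most
`K ^ ((p-2)/(p-1)) * A ^ (1/(p-1))`. The exponents add up to one. -/
theorem average_mul_average_inv_le {p : ℝ} (hp : 2 < p) {s : Set X} (hs : MeasurableSet s)
    (hs0 : μ s ≠ 0) (hst : μ s ≠ ∞)
    {w G : X → ℝ≥0∞} (hw : Measurable w) (hw0 : ∀ x, w x ≠ 0) (hwt : ∀ x, w x ≠ ∞)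
    (hG : Measurable G) (hGi : ∫⁻ x in s, G x ∂μ ≠ ∞) {K A : ℝ≥0∞}
    (hK : ∀ x ∈ s, (∫⁻ y in s, G y ∂μ) / μ s ≤ K * G x)
    (hA : (∫⁻ x in s, w x ∂μ) / μ s *
      ((∫⁻ x in s, w x ^ (-1 / (p - 1)) ∂μ) / μ s) ^ (p - 1) ≤ A) :
    (∫⁻ x in s, G x ^ ((p - 2) / (p - 1)) * w x ^ (1 / (p - 1)) ∂μ) / μ s *
      ((∫⁻ x in s, (G x ^ ((p - 2) / (p - 1)) * w x ^ (1 / (p - 1)))⁻¹ ∂μ) / μ s) ≤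
      K ^ ((p - 2) / (p - 1)) * A ^ (1 / (p - 1)) := by
  have hp1 : 0 < p - 1 := by linarith
  set t := (p - 2) / (p - 1) with ht
  set r := 1 / (p - 1) with hr
  have ht0 : 0 < t := div_pos (by linarith) hp1
  have hr0 : 0 < r := by positivity
  have htr : t + r = 1 := by rw [ht, hr]; field_simp; ring
  set g := (∫⁻ y in s, G y ∂μ) / μ s with hg
  have hgt : g ≠ ∞ := ENNReal.div_ne_top hGi hs0
  have h1 := average_rpow_mul_rpow_le hs0 hst hG hw ht0.le hr0.le htr
  rw [← hg] at h1
  -- If `G` vanishes almost everywhere on `s`, the product is `0` times a possibly infinite factor.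
  rcases eq_or_ne g 0 with h0 | h0
  · rw [h0, ENNReal.zero_rpow_of_pos ht0, zero_mul] at h1
    rw [le_zero_iff.1 h1, zero_mul]
    exact zero_le
  · have hv : Measurable fun x => w x ^ (-1 / (p - 1)) := hw.pow_const _
    have h2 : (∫⁻ x in s, (G x ^ t * w x ^ r)⁻¹ ∂μ) / μ s ≤
        (K / g) ^ t * ((∫⁻ x in s, w x ^ (-1 / (p - 1)) ∂μ) / μ s) := by
      rw [← mul_div_assoc, ← lintegral_const_mul _ hv]
      gcongr ?_ / _
      refine setLIntegral_mono' hs fun x hx => ?_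
      have hwr0 : w x ^ r ≠ 0 := (ENNReal.rpow_pos (pos_iff_ne_zero.2 (hw0 x)) (hwt x)).ne'
      have hwrt : w x ^ r ≠ ∞ := ENNReal.rpow_ne_top_of_nonneg hr0.le (hwt x)
      rw [ENNReal.mul_inv (Or.inr hwrt) (Or.inr hwr0), ← ENNReal.rpow_neg (w x),
        ← ENNReal.inv_rpow, hr, neg_div]
      gcongr
      rw [ENNReal.le_div_iff_mul_le (Or.inl h0) (Or.inl hgt)]
      rw [mul_comm, ← div_eq_mul_inv]
      exact ENNReal.div_le_of_le_mul (hK x hx)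
    calc _ ≤ (g ^ t * ((∫⁻ x in s, w x ∂μ) / μ s) ^ r) *
          ((K / g) ^ t * ((∫⁻ x in s, w x ^ (-1 / (p - 1)) ∂μ) / μ s)) := by gcongr
      _ = K ^ t * ((∫⁻ x in s, w x ∂μ) / μ s *
            ((∫⁻ x in s, w x ^ (-1 / (p - 1)) ∂μ) / μ s) ^ (p - 1)) ^ r := by
          have e1 : g ^ t * (K / g) ^ t = K ^ t := by
            rw [← ENNReal.mul_rpow_of_nonneg _ _ ht0.le, ENNReal.mul_div_cancel h0 hgt]
          have e2 : ∀ V : ℝ≥0∞, (V ^ (p - 1)) ^ r = V := by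
            intro V
            rw [← ENNReal.rpow_mul, hr, mul_one_div_cancel hp1.ne', ENNReal.rpow_one]
          rw [ENNReal.mul_rpow_of_nonneg _ _ hr0.le, e2, ← e1]
          ring
      _ ≤ _ := by gcongr

end RubioDeFrancia

/-! ### The maximal function of the tents -/

section TentMaximal

variable {n : ℕ}

local notation "E" => EuclideanSpace ℝ (Fin n)

theorem average_le_mul_average {X : Type*} [MeasurableSpace X] {μ : Measure X} {s s' : Set X}
    {D : ℝ≥0∞} (hss : s ⊆ s') (h0 : μ s' ≠ 0) (ht : μ s' ≠ ∞) (hD : μ s' ≤ D * μ s)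
    (f : X → ℝ≥0∞) :
    (∫⁻ x in s, f x ∂μ) / μ s ≤ D * ((∫⁻ x in s', f x ∂μ) / μ s') := by
  have hinv : (μ s)⁻¹ ≤ D * (μ s')⁻¹ := by
    calc (μ s)⁻¹ = μ s' / μ s * (μ s')⁻¹ := by
          rw [div_eq_mul_inv, mul_right_comm, ENNReal.mul_inv_cancel h0 ht, one_mul]
      _ ≤ D * (μ s')⁻¹ := by gcongr; exact ENNReal.div_le_of_le_mul hD
  calc (∫⁻ x in s, f x ∂μ) / μ s ≤ (∫⁻ x in s', f x ∂μ) * (D * (μ s')⁻¹) := by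
        rw [div_eq_mul_inv]
        gcongr
    _ = _ := by rw [div_eq_mul_inv]; ring

/-- A tent contained in some Carleson box whose measure exceeds that of the tent at most by the
factor `D`. A tent above a cube that barely meets the sphere need not be of this kind. -/
def IsGoodTent (α : ℝ) (D : ℝ≥0) (t : Fin n → Bool) (j : ℕ × (Fin n → ℤ)) : Prop :=
  ∃ x ∈ sphere (0 : EuclideanSpace ℝ (Fin n)) 1, ∃ s : ℝ, 0 < s ∧
    tent t j ⊆ carlesonBox (sphereBall x s) ∧
    nu n α (carlesonBox (sphereBall x s)) ≤ D * nu n α (tent t j)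

/-- The good tents of all grids, as one family. -/
def goodTent (α : ℝ) (D : ℝ≥0)
    (i : Σ t : Fin n → Bool, {j : ℕ × (Fin n → ℤ) // IsGoodTent α D t j}) :
    Set (EuclideanSpace ℝ (Fin n)) :=
  tent i.1 i.2.1

/-- The maximal function over the good tents of all grids. -/
noncomputable def tentMaximal (α : ℝ) (D : ℝ≥0) :
    (EuclideanSpace ℝ (Fin n) → ℝ≥0∞) → EuclideanSpace ℝ (Fin n) → ℝ≥0∞ :=
  maximalFn (nu n α) (goodTent α D)

/-- The maximal function over good tents controls the averages over Carleson boxes. -/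
theorem exists_average_le_tentMaximal (hn : 2 ≤ n) {α : ℝ} (hα : -1 < α) :
    ∃ D : ℝ≥0, ∀ (u : E → ℝ≥0∞), ∀ x ∈ sphere (0 : E) 1, ∀ s, 0 < s →
      ∀ z ∈ carlesonBox (sphereBall x s),
      (∫⁻ y in carlesonBox (sphereBall x s), u y ∂(nu n α)) / nu n α (carlesonBox (sphereBall x s))
        ≤ D * tentMaximal α D u z := by
  have hfin := isFiniteMeasure_nu (n := n) (by omega) hα
  have hn' : (2 : ℝ) ≤ n := by exact_mod_cast hn
  obtain ⟨D, hD⟩ := nu_carlesonBox_doubling hn hα (K := 13 * n) (by linarith)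
  refine ⟨D, fun u x hx s hs z hz => ?_⟩
  obtain ⟨t, j, s', hs', hle, h1, h2⟩ := exists_tent_between hn hx hs
  have hdoub := hD x hx x hx s hs s' hs' hle
  have hgood : IsGoodTent α D t j :=
    ⟨x, hx, s', hs', h2, hdoub.trans (by gcongr)⟩
  have h0 : nu n α (tent t j) ≠ 0 := fun h =>
    nu_carlesonBox_pos hn hα hx hs (measure_mono_null h1 h)
  refine (average_le_mul_average h1 h0 (measure_ne_top _ _)
    ((measure_mono h2).trans hdoub) u).trans ?_
  gcongr
  exact average_le_maximalFn (T := goodTent α D) u (i := ⟨t, j, hgood⟩) (h1 hz)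

theorem measurableSet_goodTent (α : ℝ) (D : ℝ≥0)
    (i : Σ t : Fin n → Bool, {j : ℕ × (Fin n → ℤ) // IsGoodTent α D t j}) :
    MeasurableSet (goodTent α D i) :=
  (isDyadicFamily_tent i.1).measurableSet i.2.1

/-- The maximal function over the good tents of the grid shifted by `t`, a dyadic family. -/
noncomputable def gridMaximal (α : ℝ) (D : ℝ≥0) (t : Fin n → Bool) :
    (EuclideanSpace ℝ (Fin n) → ℝ≥0∞) → EuclideanSpace ℝ (Fin n) → ℝ≥0∞ :=
  maximalFn (nu n α) fun j : {j // IsGoodTent α D t j} => tent t j.1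

theorem tentMaximal_rpow_le (α : ℝ) (D : ℝ≥0) (u : E → ℝ≥0∞) (q : ℝ) (x : E) :
    tentMaximal α D u x ^ q ≤ ∑ t : Fin n → Bool, gridMaximal α D t u x ^ q := by
  have hsup : tentMaximal α D u x = ⨆ t : Fin n → Bool, gridMaximal α D t u x := by
    simp only [tentMaximal, gridMaximal, maximalFn, iSup_sigma, goodTent]
  obtain ⟨t, ht⟩ := exists_eq_ciSup_of_finite (f := fun t : Fin n → Bool => gridMaximal α D t u x)
  rw [hsup, ← ht]
  exact Finset.single_le_sum (f := fun t : Fin n → Bool => gridMaximal α D t u x ^ q)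
    (fun _ _ => zero_le) (Finset.mem_univ t)

theorem measurable_gridMaximal (α : ℝ) (D : ℝ≥0) (t : Fin n → Bool) (u : E → ℝ≥0∞) :
    Measurable (gridMaximal α D t u) := by
  unfold gridMaximal
  exact measurable_maximalFn (T := fun j : {j // IsGoodTent α D t j} => tent t j.1)
    (fun j => (isDyadicFamily_tent t).measurableSet j.1) u

theorem IsGoodTent.nu_ne_zero (hn : 2 ≤ n) {α : ℝ} (hα : -1 < α) {D : ℝ≥0} {t : Fin n → Bool}
    {j : ℕ × (Fin n → ℤ)} (hj : IsGoodTent α D t j) : nu n α (tent t j) ≠ 0 := by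
  intro h0
  obtain ⟨x, hx, s, hs, -, h⟩ := hj
  rw [h0, mul_zero] at h
  exact nu_carlesonBox_pos hn hα hx hs (le_zero_iff.1 h)

/-- The weight `w` has `B_{p,α}` constant at most `A`. Here `-1 / (p - 1)` is `1 - p'`. -/
def BoxAverageBound (p α : ℝ) (w : EuclideanSpace ℝ (Fin n) → ℝ≥0∞) (A : ℝ≥0∞) : Prop :=
  ∀ x ∈ sphere (0 : EuclideanSpace ℝ (Fin n)) 1, ∀ s : ℝ, 0 < s →
    (∫⁻ z in carlesonBox (sphereBall x s), w z ∂(nu n α)) /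
        nu n α (carlesonBox (sphereBall x s)) *
      ((∫⁻ z in carlesonBox (sphereBall x s), w z ^ (-1 / (p - 1)) ∂(nu n α)) /
        nu n α (carlesonBox (sphereBall x s))) ^ (p - 1) ≤ A

theorem IsGoodTent.average_mul_average_rpow_le (hn : 2 ≤ n) {α : ℝ} (hα : -1 < α) {D : ℝ≥0}
    {t : Fin n → Bool} {j : ℕ × (Fin n → ℤ)} (hj : IsGoodTent α D t j) {p : ℝ} (hp : 1 < p)
    {w : E → ℝ≥0∞} {A : ℝ≥0∞} (hA : BoxAverageBound p α w A) :
    (∫⁻ z in tent t j, w z ∂(nu n α)) / nu n α (tent t j) *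
      ((∫⁻ z in tent t j, w z ^ (-1 / (p - 1)) ∂(nu n α)) / nu n α (tent t j)) ^ (p - 1) ≤
      D ^ p * A := by
  have hp1 : 0 < p - 1 := by linarith
  have hfin := isFiniteMeasure_nu (n := n) (by omega) hα
  obtain ⟨x, hx, s, hs, hsub, h⟩ := hj
  have hav := average_le_mul_average hsub (nu_carlesonBox_pos hn hα hx hs)
    (measure_ne_top _ _) h
  have hD : (D : ℝ≥0∞) ^ p = D * D ^ (p - 1) := by
    have := ENNReal.rpow_add_of_nonneg (x := D) 1 (p - 1) zero_le_one hp1.le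
    rwa [ENNReal.rpow_one, add_sub_cancel] at this
  refine (mul_le_mul' (hav _) (ENNReal.rpow_le_rpow (hav _) hp1.le)).trans ?_
  rw [ENNReal.mul_rpow_of_nonneg _ _ hp1.le, hD, mul_mul_mul_comm]
  exact mul_le_mul_right (hA x hx s hs) _

theorem lintegral_gridMaximal_rpow_mul_le (hn : 2 ≤ n) {α : ℝ} (hα : -1 < α)
    {p : ℝ} (hp : 1 < p) :
    ∃ C : ℝ≥0, ∀ (D : ℝ≥0) (t : Fin n → Bool) (w u : E → ℝ≥0∞), Measurable w →
      (∀ x, w x ≠ 0) → (∀ x, w x ≠ ∞) → Measurable u →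
      ∫⁻ x, w x ∂(nu n α) ≠ ∞ → ∫⁻ x, w x ^ (-1 / (p - 1)) ∂(nu n α) ≠ ∞ →
      ∀ A : ℝ≥0∞, BoxAverageBound p α w A →
      ∫⁻ x, gridMaximal α D t u x ^ (p / (p - 1)) * w x ^ (-1 / (p - 1)) ∂(nu n α) ≤
        C * (D ^ p * A) ^ (p / (p - 1)) *
          ∫⁻ x, u x ^ (p / (p - 1)) * w x ^ (-1 / (p - 1)) ∂(nu n α) := by
  have hfin := isFiniteMeasure_nu (n := n) (by omega) hα
  obtain ⟨C, hC⟩ := lintegral_maximalFn_rpow_mul_le.{0, 0} hp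
  refine ⟨C, fun D t w u hw hw0 hwt hu hwi hvi A hA => ?_⟩
  have hdy : IsDyadicFamily (fun j : {j // IsGoodTent α D t j} => tent t j.1)
      (fun j => j.1.1) :=
    ⟨fun j => (isDyadicFamily_tent t).measurableSet j.1, fun i j hij hle =>
      (isDyadicFamily_tent t).nested i.1 j.1 (fun h => hij (Subtype.ext h)) hle⟩
  exact hC hdy (fun j => j.2.nu_ne_zero hn hα) (fun j => measure_ne_top _ _) hw hw0 hwt hu hwi hvi
    (fun j => j.2.average_mul_average_rpow_le hn hα hp hA)

theorem lintegral_tentMaximal_rpow_mul_le (hn : 2 ≤ n) {α : ℝ} (hα : -1 < α) (D : ℝ≥0)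
    {p : ℝ} (hp : 1 < p) :
    ∃ C : ℝ≥0, 0 < C ∧ ∀ (w u : E → ℝ≥0∞), Measurable w → (∀ x, w x ≠ 0) → (∀ x, w x ≠ ∞) →
      Measurable u → ∫⁻ x, w x ∂(nu n α) ≠ ∞ → ∫⁻ x, w x ^ (-1 / (p - 1)) ∂(nu n α) ≠ ∞ →
      ∀ A : ℝ≥0∞, BoxAverageBound p α w A →
      ∫⁻ x, tentMaximal α D u x ^ (p / (p - 1)) * w x ^ (-1 / (p - 1)) ∂(nu n α) ≤
        (C * A) ^ (p / (p - 1)) *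
          ∫⁻ x, u x ^ (p / (p - 1)) * w x ^ (-1 / (p - 1)) ∂(nu n α) := by
  have hp1 : 0 < p - 1 := by linarith
  have hq0 : 0 < p / (p - 1) := by positivity
  obtain ⟨C, hC⟩ := lintegral_gridMaximal_rpow_mul_le hn hα hp
  set q := p / (p - 1) with hq
  set c : ℝ≥0 := Fintype.card (Fin n → Bool) * C + 1 with hc
  have hc0 : 0 < c := by positivity
  refine ⟨c ^ (1 / q) * (D + 1) ^ p, by positivity, ?_⟩
  intro w u hw hw0 hwt hu hwi hvi A hA
  calc ∫⁻ x, tentMaximal α D u x ^ q * w x ^ (-1 / (p - 1)) ∂(nu n α)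
      ≤ ∫⁻ x, ∑ t : Fin n → Bool,
          gridMaximal α D t u x ^ q * w x ^ (-1 / (p - 1)) ∂(nu n α) := by
        refine lintegral_mono fun x => ?_
        rw [← Finset.sum_mul]
        exact mul_le_mul_left (tentMaximal_rpow_le α D u q x) _
    _ = ∑ t : Fin n → Bool, ∫⁻ x,
          gridMaximal α D t u x ^ q * w x ^ (-1 / (p - 1)) ∂(nu n α) :=
        lintegral_finsetSum _ fun t _ =>
          ((measurable_gridMaximal α D t u).pow_const q).mul (hw.pow_const _)
    _ ≤ ∑ _t : Fin n → Bool,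
          C * (D ^ p * A) ^ q * ∫⁻ x, u x ^ q * w x ^ (-1 / (p - 1)) ∂(nu n α) :=
        Finset.sum_le_sum fun t _ => hC D t w u hw hw0 hwt hu hwi hvi A hA
    _ = (Fintype.card (Fin n → Bool) * C : ℝ≥0) * (D ^ p * A) ^ q *
          ∫⁻ x, u x ^ q * w x ^ (-1 / (p - 1)) ∂(nu n α) := by
        rw [Finset.sum_const, nsmul_eq_mul, Finset.card_univ, ENNReal.coe_mul, ENNReal.coe_natCast,
          mul_assoc, mul_assoc, mul_assoc]
    _ ≤ c * ((D + 1 : ℝ≥0) ^ p * A) ^ q *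
          ∫⁻ x, u x ^ q * w x ^ (-1 / (p - 1)) ∂(nu n α) := by
        have h1 : ((Fintype.card (Fin n → Bool) * C : ℝ≥0) : ℝ≥0∞) ≤ c :=
          ENNReal.coe_le_coe.2 (le_add_of_nonneg_right zero_le_one)
        have h2 : (D : ℝ≥0∞) ≤ (D + 1 : ℝ≥0) :=
          ENNReal.coe_le_coe.2 (le_add_of_nonneg_right zero_le_one)
        gcongr
    _ = _ := by
        congr 1
        rw [ENNReal.coe_mul, ENNReal.coe_rpow_of_nonneg c (by positivity), mul_assoc,
          ENNReal.mul_rpow_of_nonneg (c ^ (1 / q) : ℝ≥0∞) _ hq0.le, ← ENNReal.rpow_mul,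
          one_div_mul_cancel hq0.ne', ENNReal.rpow_one,
          ENNReal.coe_rpow_of_nonneg (D + 1) (by positivity)]

end TentMaximal

/-! ### Extrapolation for a fixed pair of functions -/

section Extrapolation

variable {n : ℕ}

local notation "E" => EuclideanSpace ℝ (Fin n)

theorem lintegral_ne_top_of_rpow_mul {X : Type*} [MeasurableSpace X] {μ : Measure X} {p : ℝ}
    (hp : 1 < p) {w G : X → ℝ≥0∞} (hw : Measurable w) (hw0 : ∀ x, w x ≠ 0) (hwt : ∀ x, w x ≠ ∞)
    (hG : Measurable G) (hwi : ∫⁻ x, w x ∂μ ≠ ∞)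
    (hGi : ∫⁻ x, G x ^ (p / (p - 1)) * w x ^ (-1 / (p - 1)) ∂μ ≠ ∞) : ∫⁻ x, G x ∂μ ≠ ∞ := by
  have hp1 : 0 < p - 1 := by linarith
  have hp0 : 0 < p := by linarith
  have hpt : ∀ x, G x = (G x ^ (p / (p - 1)) * w x ^ (-1 / (p - 1))) ^ ((p - 1) / p) *
      w x ^ (1 / p) := by
    intro x
    rw [ENNReal.mul_rpow_of_nonneg _ _ (by positivity), ← ENNReal.rpow_mul, ← ENNReal.rpow_mul,
      mul_assoc, ← ENNReal.rpow_add _ _ (hw0 x) (hwt x)]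
    have h1 : p / (p - 1) * ((p - 1) / p) = 1 := by field_simp
    have h2 : -1 / (p - 1) * ((p - 1) / p) + 1 / p = 0 := by field_simp; ring
    rw [h1, h2, ENNReal.rpow_one, ENNReal.rpow_zero, mul_one]
  rw [lintegral_congr hpt]
  refine ne_top_of_le_ne_top ?_ (ENNReal.lintegral_mul_norm_pow_le
    ((hG.pow_const _).mul (hw.pow_const _)).aemeasurable hw.aemeasurable
    (by positivity) (by positivity) (by field_simp; ring))
  exact ENNReal.mul_ne_top (ENNReal.rpow_ne_top_of_nonneg (by positivity) hGi)
    (ENNReal.rpow_ne_top_of_nonneg (by positivity) hwi)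

/-- The weight `Ω` has `B_{2,α}` constant at most `B`. -/
def BoxA2Bound (α : ℝ) (Ω : EuclideanSpace ℝ (Fin n) → ℝ≥0∞) (B : ℝ≥0∞) : Prop :=
  ∀ x ∈ sphere (0 : EuclideanSpace ℝ (Fin n)) 1, ∀ s : ℝ, 0 < s →
    (∫⁻ z in carlesonBox (sphereBall x s), Ω z ∂(nu n α)) /
        nu n α (carlesonBox (sphereBall x s)) *
      ((∫⁻ z in carlesonBox (sphereBall x s), (Ω z)⁻¹ ∂(nu n α)) /
        nu n α (carlesonBox (sphereBall x s))) ≤ B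

/-- A majorant `G` of `U` with comparable norm in `L^{p'}(w^{1-p'})` for which the interpolated
weight has `B_{2,α}` constant linear in the `B_{p,α}` constant of `w`. -/
theorem exists_majorant_boxA2Bound (hn : 2 ≤ n) {α : ℝ} (hα : -1 < α) {p : ℝ} (hp : 2 < p) :
    ∃ C : ℝ≥0, ∀ (w U : E → ℝ≥0∞), Measurable w → (∀ x, w x ≠ 0) → (∀ x, w x ≠ ∞) →
      Measurable U → ∫⁻ x, w x ∂(nu n α) ≠ ∞ → ∫⁻ x, w x ^ (-1 / (p - 1)) ∂(nu n α) ≠ ∞ →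
      ∀ A : ℝ≥0∞, A ≠ 0 → A ≠ ∞ → BoxAverageBound p α w A →
      ∫⁻ x, U x ^ (p / (p - 1)) * w x ^ (-1 / (p - 1)) ∂(nu n α) ≠ ∞ →
      ∃ G : E → ℝ≥0∞, Measurable G ∧ (∀ x, U x ≤ G x) ∧ ∫⁻ x, G x ∂(nu n α) ≠ ∞ ∧
        ∫⁻ x, G x ^ (p / (p - 1)) * w x ^ (-1 / (p - 1)) ∂(nu n α) ≤
          2 ^ (p / (p - 1)) * ∫⁻ x, U x ^ (p / (p - 1)) * w x ^ (-1 / (p - 1)) ∂(nu n α) ∧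
        BoxA2Bound α (fun x => G x ^ ((p - 2) / (p - 1)) * w x ^ (1 / (p - 1))) (C * A) := by
  have hp1 : 0 < p - 1 := by linarith
  have ht0 : 0 ≤ (p - 2) / (p - 1) := div_nonneg (by linarith) hp1.le
  have hq : 1 ≤ p / (p - 1) := by rw [le_div_iff₀ hp1]; linarith
  have hfin := isFiniteMeasure_nu (n := n) (by omega) hα
  obtain ⟨D, hD⟩ := exists_average_le_tentMaximal hn hα
  obtain ⟨C, hC0, hC⟩ := lintegral_tentMaximal_rpow_mul_le hn hα D (p := p) (by linarith)
  refine ⟨(D * (2 * C)) ^ ((p - 2) / (p - 1)), ?_⟩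
  intro w U hw hw0 hwt hU hwi hvi A hA0 hAt hA hUi
  obtain ⟨G, hG, hUG, hMG, hGi⟩ := exists_majorant_maximalFn_le (μ := nu n α)
    (measurableSet_goodTent α D) hq (hw.pow_const (-1 / (p - 1))) (Λ := C * A)
    (mul_ne_zero (by exact_mod_cast hC0.ne') hA0) (ENNReal.mul_ne_top ENNReal.coe_ne_top hAt)
    (fun u hu => hC w u hw hw0 hwt hu hwi hvi A hA) hU
  have hGt : ∫⁻ x, G x ∂(nu n α) ≠ ∞ :=
    lintegral_ne_top_of_rpow_mul (by linarith) hw hw0 hwt hG hwi (ne_top_of_le_ne_top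
      (ENNReal.mul_ne_top (ENNReal.rpow_ne_top_of_nonneg (by linarith) (by simp)) hUi) hGi)
  refine ⟨G, hG, hUG, hGt, hGi, fun x hx s hs => ?_⟩
  refine (average_mul_average_inv_le hp (measurableSet_carlesonBox x s)
    (nu_carlesonBox_pos hn hα hx hs) (measure_ne_top _ _) hw hw0 hwt hG
    (ne_top_of_le_ne_top hGt (setLIntegral_le_lintegral _ _)) (K := D * (2 * (C * A)))
    (fun z hz => ?_) (hA x hx s hs)).trans (le_of_eq ?_)
  · refine (hD G x hx s hs z hz).trans ?_
    rw [mul_assoc (D : ℝ≥0∞)]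
    exact mul_le_mul_right (hMG z) _
  · have h1 : (D : ℝ≥0∞) * (2 * (C * A)) = (D * (2 * C) : ℝ≥0) * A := by
      push_cast; ring
    rw [h1, ENNReal.mul_rpow_of_nonneg _ _ ht0, mul_assoc, ← ENNReal.rpow_add _ _ hA0 hAt,
      ENNReal.coe_rpow_of_nonneg _ ht0]
    have h2 : (p - 2) / (p - 1) + 1 / (p - 1) = 1 := by field_simp; ring
    rw [h2, ENNReal.rpow_one]

/-- A self-improving inequality for a finite quantity can be solved for it. -/
theorem le_rpow_of_le_mul_rpow {I Y : ℝ≥0∞} {a b : ℝ} (ha : 0 < a) (hab : a + b = 1)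
    (hI : I ≠ ∞) (h : I ≤ Y * I ^ b) : I ≤ Y ^ (1 / a) := by
  rcases eq_or_ne I 0 with rfl | h0
  · exact zero_le
  rw [one_div, ENNReal.le_rpow_inv_iff ha]
  have h1 : I ^ a * I ^ b = I := by
    rw [← ENNReal.rpow_add _ _ h0 hI, hab, ENNReal.rpow_one]
  have hb0 : I ^ b ≠ 0 := (ENNReal.rpow_pos (pos_iff_ne_zero.2 h0) hI).ne'
  have hbt : I ^ b ≠ ∞ := by
    simp [ENNReal.rpow_eq_top_iff, h0, hI]
  rw [← ENNReal.mul_le_mul_iff_left hb0 hbt, h1]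
  exact h

theorem lintegral_sq_mul_le {X : Type*} [MeasurableSpace X] {μ : Measure X} {p : ℝ} (hp : 2 < p)
    {w f G : X → ℝ≥0∞} (hw : Measurable w) (hw0 : ∀ x, w x ≠ 0) (hwt : ∀ x, w x ≠ ∞)
    (hf : Measurable f) (hG : Measurable G) :
    ∫⁻ x, f x ^ (2 : ℝ) * (G x ^ ((p - 2) / (p - 1)) * w x ^ (1 / (p - 1))) ∂μ ≤
      (∫⁻ x, f x ^ p * w x ∂μ) ^ (2 / p) *
        (∫⁻ x, G x ^ (p / (p - 1)) * w x ^ (-1 / (p - 1)) ∂μ) ^ ((p - 2) / p) := by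
  have hp1 : 0 < p - 1 := by linarith
  have hp2 : 0 < p - 2 := by linarith
  have hp0 : 0 < p := by linarith
  have hpt : ∀ x, f x ^ (2 : ℝ) * (G x ^ ((p - 2) / (p - 1)) * w x ^ (1 / (p - 1))) =
      (f x ^ p * w x) ^ (2 / p) *
        (G x ^ (p / (p - 1)) * w x ^ (-1 / (p - 1))) ^ ((p - 2) / p) := by
    intro x
    rw [ENNReal.mul_rpow_of_nonneg _ _ (by positivity),
      ENNReal.mul_rpow_of_nonneg _ _ (by positivity), ← ENNReal.rpow_mul, ← ENNReal.rpow_mul,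
      ← ENNReal.rpow_mul]
    have h1 : p * (2 / p) = 2 := by field_simp
    have h2 : p / (p - 1) * ((p - 2) / p) = (p - 2) / (p - 1) := by field_simp
    have h3 : 1 / (p - 1) = 2 / p + -1 / (p - 1) * ((p - 2) / p) := by field_simp; ring
    rw [h1, h2, h3, ENNReal.rpow_add _ _ (hw0 x) (hwt x)]
    ring
  rw [lintegral_congr hpt]
  exact ENNReal.lintegral_mul_norm_pow_le ((hf.pow_const _).mul hw).aemeasurable
    ((hG.pow_const _).mul (hw.pow_const _)).aemeasurable (by positivity) (by positivity)
    (by field_simp; ring)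

/-- Extrapolation for a pair of functions: weighted `L²` inequalities, linear in the `B_{2,α}`
constant of the weight, imply the weighted `L^p` inequality, linear in the `B_{p,α}` constant. -/
theorem lintegral_rpow_mul_le_of_forall_sq (hn : 2 ≤ n) {α : ℝ} (hα : -1 < α) {p : ℝ}
    (hp : 2 < p) (C₂ : ℝ≥0) :
    ∃ C : ℝ≥0, ∀ (w f g : E → ℝ≥0∞), Measurable w → (∀ x, w x ≠ 0) → (∀ x, w x ≠ ∞) →
      Measurable f → Measurable g →
      ∫⁻ x, w x ∂(nu n α) ≠ ∞ → ∫⁻ x, w x ^ (-1 / (p - 1)) ∂(nu n α) ≠ ∞ →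
      ∀ A : ℝ≥0∞, A ≠ 0 → A ≠ ∞ → BoxAverageBound p α w A →
      (∀ Ω : E → ℝ≥0∞, Measurable Ω → ∫⁻ x, Ω x ∂(nu n α) ≠ ∞ →
        ∀ B : ℝ≥0∞, B ≠ ∞ → BoxA2Bound α Ω B →
        ∫⁻ x, f x ^ (2 : ℝ) * Ω x ∂(nu n α) ≠ ∞ →
        ∫⁻ x, g x ^ (2 : ℝ) * Ω x ∂(nu n α) ≤
          (C₂ * B) ^ (2 : ℝ) * ∫⁻ x, f x ^ (2 : ℝ) * Ω x ∂(nu n α)) →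
      ∫⁻ x, f x ^ p * w x ∂(nu n α) ≠ ∞ →
      ∫⁻ x, g x ^ p * w x ∂(nu n α) ≤ (C * A) ^ p * ∫⁻ x, f x ^ p * w x ∂(nu n α) := by
  have hp1 : 0 < p - 1 := by linarith
  have hp2 : 0 < p - 2 := by linarith
  have hp0 : 0 < p := by linarith
  obtain ⟨C, hC⟩ := exists_majorant_boxA2Bound hn hα hp
  set t := (p - 2) / (p - 1) with ht
  have ht0 : 0 < t := div_pos hp2 hp1
  refine ⟨C₂ * C * 2 ^ (t / 2), ?_⟩
  intro w f g hw hw0 hwt hf hg hwi hvi A hA0 hAt hA hyp hfi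
  set F := ∫⁻ x, f x ^ p * w x ∂(nu n α) with hF
  have main : ∀ N : ℕ, ∫⁻ x, min (g x) N ^ p * w x ∂(nu n α) ≤
      ((C₂ * C * 2 ^ (t / 2) : ℝ≥0) * A) ^ p * F := by
    intro N
    -- Truncation makes `I` finite, which is needed in order to divide by a power of `I`.
    set m : E → ℝ≥0∞ := fun x => min (g x) N with hm
    have hmm : Measurable m := hg.min measurable_const
    set I := ∫⁻ x, m x ^ p * w x ∂(nu n α) with hI
    have hIt : I ≠ ∞ := by
      refine ne_top_of_le_ne_top ?_ (lintegral_mono (g := fun x => (N : ℝ≥0∞) ^ p * w x)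
        fun x => ?_)
      · rw [lintegral_const_mul _ hw]
        exact ENNReal.mul_ne_top (ENNReal.rpow_ne_top_of_nonneg hp0.le (by simp)) hwi
      · exact mul_le_mul_left (ENNReal.rpow_le_rpow (min_le_right _ _) hp0.le) _
    have hU : ∀ x, (m x ^ (p - 1) * w x) ^ (p / (p - 1)) * w x ^ (-1 / (p - 1)) =
        m x ^ p * w x := by
      intro x
      rw [ENNReal.mul_rpow_of_nonneg _ _ (by positivity), ← ENNReal.rpow_mul, mul_assoc,
        ← ENNReal.rpow_add _ _ (hw0 x) (hwt x)]
      have h1 : (p - 1) * (p / (p - 1)) = p := by field_simp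
      have h2 : p / (p - 1) + -1 / (p - 1) = 1 := by field_simp; ring
      rw [h1, h2, ENNReal.rpow_one]
    -- `U = m ^ (p - 1) * w` is chosen so that its norm is `I` and `U ^ t * w ^ (1 / (p - 1))` is
    -- `m ^ (p - 2) * w`, the function dual to `m ^ 2` in `L^{p/2}(w)`.
    obtain ⟨G, hG, hUG, hGt, hGi, hA2⟩ := hC w (fun x => m x ^ (p - 1) * w x) hw hw0 hwt
      ((hmm.pow_const _).mul hw) hwi hvi A hA0 hAt hA (by rw [lintegral_congr hU]; exact hIt)
    rw [lintegral_congr hU] at hGi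
    set Ω : E → ℝ≥0∞ := fun x => G x ^ t * w x ^ (1 / (p - 1)) with hΩ
    have hΩm : Measurable Ω := (hG.pow_const _).mul (hw.pow_const _)
    have hΩi : ∫⁻ x, Ω x ∂(nu n α) ≠ ∞ := by
      refine ne_top_of_le_ne_top ?_ (ENNReal.lintegral_mul_norm_pow_le hG.aemeasurable
        hw.aemeasurable ht0.le (by positivity) (by rw [ht]; field_simp; ring))
      exact ENNReal.mul_ne_top (ENNReal.rpow_ne_top_of_nonneg ht0.le hGt)
        (ENNReal.rpow_ne_top_of_nonneg (by positivity) hwi)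
    have hholder : ∫⁻ x, f x ^ (2 : ℝ) * Ω x ∂(nu n α) ≤
        F ^ (2 / p) * (2 ^ (p / (p - 1)) * I) ^ ((p - 2) / p) := by
      refine (lintegral_sq_mul_le hp hw hw0 hwt hf hG).trans ?_
      gcongr
    have hfΩ : ∫⁻ x, f x ^ (2 : ℝ) * Ω x ∂(nu n α) ≠ ∞ := by
      refine ne_top_of_le_ne_top (ENNReal.mul_ne_top
        (ENNReal.rpow_ne_top_of_nonneg (by positivity) hfi)
        (ENNReal.rpow_ne_top_of_nonneg (by positivity) (ENNReal.mul_ne_top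
          (ENNReal.rpow_ne_top_of_nonneg (by positivity) (by simp)) hIt))) hholder
    have hlow : I ≤ ∫⁻ x, g x ^ (2 : ℝ) * Ω x ∂(nu n α) := by
      refine lintegral_mono fun x => ?_
      calc m x ^ p * w x = m x ^ (2 : ℝ) * ((m x ^ (p - 1) * w x) ^ t * w x ^ (1 / (p - 1))) := by
            have h1 : (p - 1) * t = p - 2 := by rw [ht]; field_simp
            have h2 : t + 1 / (p - 1) = 1 := by rw [ht]; field_simp; ring
            rw [ENNReal.mul_rpow_of_nonneg _ _ ht0.le, ← ENNReal.rpow_mul, mul_assoc,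
              ← ENNReal.rpow_add _ _ (hw0 x) (hwt x), h1, h2, ENNReal.rpow_one, ← mul_assoc,
              ← ENNReal.rpow_add_of_nonneg _ _ zero_le_two hp2.le]
            congr 2; ring
        _ ≤ g x ^ (2 : ℝ) * (G x ^ t * w x ^ (1 / (p - 1))) := by
            gcongr
            · exact min_le_left _ _
            · exact hUG x
    have hcomb : I ≤ ((C₂ * (C * A)) ^ (2 : ℝ) * F ^ (2 / p) * 2 ^ t) * I ^ ((p - 2) / p) := by
      calc I ≤ (C₂ * (C * A)) ^ (2 : ℝ) * ∫⁻ x, f x ^ (2 : ℝ) * Ω x ∂(nu n α) :=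
            hlow.trans (hyp Ω hΩm hΩi (C * A) (ENNReal.mul_ne_top ENNReal.coe_ne_top hAt) hA2 hfΩ)
        _ ≤ (C₂ * (C * A)) ^ (2 : ℝ) * (F ^ (2 / p) * (2 ^ (p / (p - 1)) * I) ^ ((p - 2) / p)) := by
            gcongr
        _ = _ := by
            have h1 : p / (p - 1) * ((p - 2) / p) = t := by rw [ht]; field_simp
            rw [ENNReal.mul_rpow_of_nonneg (2 ^ (p / (p - 1))) I (by positivity),
              ← ENNReal.rpow_mul, h1]
            ring
    refine (le_rpow_of_le_mul_rpow (a := 2 / p) (by positivity) (by field_simp; ring) hIt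
      hcomb).trans (le_of_eq ?_)
    have e1 : 2 * (p / 2) = p := by ring
    have e2 : 2 / p * (p / 2) = 1 := by field_simp
    have e3 : t * (p / 2) = t / 2 * p := by ring
    rw [one_div_div, ENNReal.mul_rpow_of_nonneg _ _ (by positivity),
      ENNReal.mul_rpow_of_nonneg _ _ (by positivity), ← ENNReal.rpow_mul, ← ENNReal.rpow_mul,
      ← ENNReal.rpow_mul, e1, e2, e3, ENNReal.rpow_one, ENNReal.rpow_mul 2, ENNReal.coe_mul,
      ENNReal.coe_mul, ENNReal.coe_rpow_of_nonneg _ (by positivity), ENNReal.coe_ofNat,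
      mul_right_comm, ← ENNReal.mul_rpow_of_nonneg _ _ hp0.le]
    congr 2
    ring
  refine le_of_tendsto' (lintegral_tendsto_of_tendsto_of_monotone
    (f := fun N : ℕ => fun x => min (g x) N ^ p * w x) (F := fun x => g x ^ p * w x)
    (fun N => (((hg.min measurable_const).pow_const _).mul hw).aemeasurable) ?_ ?_) main
  · refine Filter.Eventually.of_forall fun x N N' hN => ?_
    have : (N : ℝ≥0∞) ≤ N' := by exact_mod_cast hN
    dsimp only
    gcongr
  · refine Filter.Eventually.of_forall fun x => ?_
    refine ENNReal.Tendsto.mul_const ?_ (Or.inr (hwt x))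
    refine ((ENNReal.continuous_rpow_const).tendsto (g x)).comp ?_
    have := (tendsto_const_nhds (x := g x)).min ENNReal.tendsto_nat_nhds_top
    rwa [min_top_right] at this

end Extrapolation

/-! ### Weights, operator norms and the conclusion -/

section OperatorNorm

variable {n : ℕ}

local notation "E" => EuclideanSpace ℝ (Fin n)

theorem eLpNorm_weightedMeasure {α : ℝ} {ω : E → ℝ} {w : E → ℝ≥0∞} (hw : Measurable w)
    (hωw : (fun x => ENNReal.ofReal (ω x)) =ᵐ[nu n α] w) {p : ℝ} (hp : 0 < p)
    {f : E → ℂ} (hf : Measurable f) :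
    eLpNorm f (ENNReal.ofReal p) (weightedMeasure α ω) =
      (∫⁻ x, ‖f x‖ₑ ^ p * w x ∂(nu n α)) ^ (1 / p) := by
  have hfm : Measurable fun x => ‖f x‖ₑ ^ p := hf.enorm.pow_const p
  rw [eLpNorm_eq_lintegral_rpow_enorm_toReal (by simpa using hp) ENNReal.ofReal_ne_top,
    ENNReal.toReal_ofReal hp.le, weightedMeasure, withDensity_congr_ae hωw,
    lintegral_withDensity_eq_lintegral_mul _ hw hfm]
  congr 1
  exact lintegral_congr fun x => mul_comm _ _

/-- The infimum in `opNorm` is attained as soon as it is finite. -/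
theorem eLpNorm_le_opNorm_mul {α p : ℝ} {ω : E → ℝ} {R : (E →ₘ[nu n α] ℂ) → (E →ₘ[nu n α] ℂ)}
    {f : E →ₘ[nu n α] ℂ} (hf : MemLp f (ENNReal.ofReal p) (weightedMeasure α ω)) {c : ℝ≥0∞}
    (hc : opNorm p ω R ≤ c) (hct : c ≠ ∞) :
    eLpNorm (R f) (ENNReal.ofReal p) (weightedMeasure α ω) ≤
      c * eLpNorm f (ENNReal.ofReal p) (weightedMeasure α ω) := by
  rcases eq_or_ne (eLpNorm f (ENNReal.ofReal p) (weightedMeasure α ω)) 0 with h0 | h0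
  · obtain ⟨b, hb, -⟩ := sInf_lt_iff.1 (hc.trans_lt hct.lt_top)
    have := hb f hf
    rw [h0, mul_zero] at this ⊢
    exact this
  · rw [← ENNReal.div_le_iff_le_mul (Or.inl h0) (Or.inl hf.2.ne)]
    refine le_trans (le_sInf fun b hb => ?_) hc
    exact ENNReal.div_le_of_le_mul (hb f hf)

theorem boxAverageBound_bbConst {p α : ℝ} {ω : E → ℝ} {w : E → ℝ≥0∞}
    (hωw : (fun x => ENNReal.ofReal (ω x)) =ᵐ[nu n α] w) (hp : 1 < p) :
    BoxAverageBound p α w (bbConst p α ω) := by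
  intro x hx s hs
  have h1 : ∀ S : Set E, ∫⁻ z in S, w z ∂(nu n α) = ∫⁻ z in S, ENNReal.ofReal (ω z) ∂(nu n α) :=
    fun S => lintegral_congr_ae (ae_restrict_of_ae hωw.symm)
  have h2 : ∀ S : Set E, ∫⁻ z in S, w z ^ (-1 / (p - 1)) ∂(nu n α) =
      ∫⁻ z in S, ENNReal.ofReal (ω z) ^ (1 - p / (p - 1)) ∂(nu n α) := by
    intro S
    have he : -1 / (p - 1) = 1 - p / (p - 1) := by
      have : p - 1 ≠ 0 := by linarith
      field_simp; ring
    rw [he]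
    refine lintegral_congr_ae (ae_restrict_of_ae ?_)
    filter_upwards [hωw] with z hz
    rw [← hz]
  rw [h1, h2, bbConst]
  exact le_iSup₂_of_le x hx (le_iSup₂_of_le s hs le_rfl)

theorem bbConst_two_le {α : ℝ} {ω : E → ℝ} {Ω : E → ℝ≥0∞}
    (hω : (fun x => ENNReal.ofReal (ω x)) =ᵐ[nu n α] Ω) {B : ℝ≥0∞} (hB : BoxA2Bound α Ω B) :
    bbConst 2 α ω ≤ B := by
  refine iSup₂_le fun x hx => iSup₂_le fun s hs => ?_
  have h1 : ∀ S : Set E, ∫⁻ z in S, ENNReal.ofReal (ω z) ∂(nu n α) = ∫⁻ z in S, Ω z ∂(nu n α) :=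
    fun S => lintegral_congr_ae (ae_restrict_of_ae hω)
  have h2 : ∀ S : Set E, ∫⁻ z in S, ENNReal.ofReal (ω z) ^ ((1 : ℝ) - 2 / (2 - 1)) ∂(nu n α) =
      ∫⁻ z in S, (Ω z)⁻¹ ∂(nu n α) := by
    intro S
    refine lintegral_congr_ae (ae_restrict_of_ae ?_)
    filter_upwards [hω] with z hz
    rw [hz, ← ENNReal.rpow_neg_one]
    norm_num
  rw [h1, h2]
  have h3 : (2 : ℝ) - 1 = 1 := by norm_num
  rw [h3, ENNReal.rpow_one]
  exact hB x hx s hs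

theorem lintegral_sq_mul_le_of_opNorm_le {α : ℝ}
    {R : (E →ₘ[nu n α] ℂ) → (E →ₘ[nu n α] ℂ)} {C₂ : ℝ≥0}
    (hR : ∀ ω : E → ℝ, IsBBWeight 2 α ω → opNorm 2 ω R ≤ C₂ * bbConst 2 α ω)
    (f : E →ₘ[nu n α] ℂ) {Ω : E → ℝ≥0∞} (hΩ : Measurable Ω) (hΩi : ∫⁻ x, Ω x ∂(nu n α) ≠ ∞)
    {B : ℝ≥0∞} (hBt : B ≠ ∞) (hB : BoxA2Bound α Ω B)
    (hf : ∫⁻ x, ‖f x‖ₑ ^ (2 : ℝ) * Ω x ∂(nu n α) ≠ ∞) :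
    ∫⁻ x, ‖R f x‖ₑ ^ (2 : ℝ) * Ω x ∂(nu n α) ≤
      (C₂ * B) ^ (2 : ℝ) * ∫⁻ x, ‖f x‖ₑ ^ (2 : ℝ) * Ω x ∂(nu n α) := by
  set ω : E → ℝ := fun x => (Ω x).toReal with hω
  have hωΩ : (fun x => ENNReal.ofReal (ω x)) =ᵐ[nu n α] Ω := by
    filter_upwards [ae_lt_top hΩ hΩi] with x hx
    exact ENNReal.ofReal_toReal hx.ne
  have hbb : bbConst 2 α ω ≤ B := bbConst_two_le hωΩ hB
  have hweight : IsBBWeight 2 α ω :=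
    ⟨⟨fun x _ => ENNReal.toReal_nonneg, integrable_toReal_of_lintegral_ne_top hΩ.aemeasurable hΩi⟩,
      hbb.trans_lt hBt.lt_top⟩
  have hop : opNorm 2 ω R ≤ C₂ * B := (hR ω hweight).trans (by gcongr)
  have hnorm : ∀ h : E →ₘ[nu n α] ℂ, eLpNorm h (ENNReal.ofReal 2) (weightedMeasure α ω) =
      (∫⁻ x, ‖h x‖ₑ ^ (2 : ℝ) * Ω x ∂(nu n α)) ^ ((1 : ℝ) / 2) := fun h =>
    eLpNorm_weightedMeasure hΩ hωΩ two_pos h.measurable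
  have hmem : MemLp f (ENNReal.ofReal 2) (weightedMeasure α ω) := by
    refine ⟨f.stronglyMeasurable.aestronglyMeasurable, ?_⟩
    rw [hnorm]
    exact ENNReal.rpow_lt_top_of_nonneg (by norm_num) hf
  have h := eLpNorm_le_opNorm_mul hmem hop (ENNReal.mul_ne_top ENNReal.coe_ne_top hBt)
  rw [hnorm, hnorm] at h
  have h' := ENNReal.rpow_le_rpow h zero_le_two
  rwa [ENNReal.mul_rpow_of_nonneg _ _ zero_le_two, ← ENNReal.rpow_mul, ← ENNReal.rpow_mul,
    one_div_mul_cancel two_ne_zero, ENNReal.rpow_one, ENNReal.rpow_one] at h'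

/-- Unless `ω` vanishes almost everywhere, a `B_{p,α}` weight agrees almost everywhere with a
measurable function with values in `(0, ∞)` whose dual weight is integrable: the box above the whole
sphere has full measure, so finiteness of the constant gives `∫ ω^{1-p'} dν_α < ∞`. -/
theorem exists_measurable_pos_representative (hn : 2 ≤ n) {α : ℝ} (hα : -1 < α) {p : ℝ}
    (hp : 1 < p) {ω : E → ℝ} (hω : IsBBWeight p α ω) (hne : weightedMeasure α ω ≠ 0) :
    ∃ w : E → ℝ≥0∞, Measurable w ∧ (∀ x, w x ≠ 0) ∧ (∀ x, w x ≠ ∞) ∧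
      (fun x => ENNReal.ofReal (ω x)) =ᵐ[nu n α] w ∧ ∫⁻ x, w x ∂(nu n α) ≠ ∞ ∧
      ∫⁻ x, w x ^ (-1 / (p - 1)) ∂(nu n α) ≠ ∞ ∧ bbConst p α ω ≠ 0 := by
  have hp1 : 0 < p - 1 := by linarith
  have hexp : -1 / (p - 1) < 0 := div_neg_of_neg_of_pos (by norm_num) hp1
  have : Nontrivial E := by
    have : Nonempty (Fin n) := ⟨⟨0, by omega⟩⟩
    infer_instance
  have hfin := isFiniteMeasure_nu (n := n) (by omega) hα
  obtain ⟨x₀, hx₀⟩ := NormedSpace.sphere_nonempty (x := (0 : E)) (r := 1) |>.2 zero_le_one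
  set B := carlesonBox (sphereBall x₀ 3) with hB
  have hBae : ∀ᵐ z ∂(nu n α), z ∈ B := by
    filter_upwards [ae_nu_mem (by omega : 1 ≤ n) α] with z hz
    rw [hB, carlesonBox_eq_sector]
    have hsub : sphere (0 : E) 1 ⊆ sphereBall x₀ 3 := by
      intro y hy
      refine ⟨hy, ?_⟩
      have h1 : dist y 0 = 1 := hy
      have h2 : dist x₀ 0 = 1 := hx₀
      linarith [dist_triangle_right y x₀ 0]
    have hd := min_le_diam_sphereBall hn hx₀ (s := 3) (by norm_num)
    rw [min_eq_right (by norm_num)] at hd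
    exact sector_mono hsub (by linarith) hz
  have hBrestrict : (nu n α).restrict B = nu n α := Measure.restrict_eq_self_of_ae_mem hBae
  have hint := hω.isWeight.integrable
  set w₀ : E → ℝ≥0∞ := fun x => ENNReal.ofReal (hint.1.mk ω x) with hw₀
  have hw₀m : Measurable w₀ := hint.1.stronglyMeasurable_mk.measurable.ennreal_ofReal
  have hωw₀ : (fun x => ENNReal.ofReal (ω x)) =ᵐ[nu n α] w₀ := by
    filter_upwards [hint.1.ae_eq_mk] with x hx
    rw [hw₀]; simp only; rw [← hx]
  have hw₀i : ∫⁻ x, w₀ x ∂(nu n α) ≠ ∞ := by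
    rw [← lintegral_congr_ae hωw₀]
    refine ne_top_of_le_ne_top hint.2.ne (lintegral_mono fun x => ?_)
    exact Real.ofReal_le_enorm _
  have hw₀0 : ∫⁻ x, w₀ x ∂(nu n α) ≠ 0 := by
    intro h
    apply hne
    rw [weightedMeasure, withDensity_congr_ae hωw₀, withDensity_eq_zero_iff hw₀m.aemeasurable]
    exact (lintegral_eq_zero_iff hw₀m).1 h
  have hbound := boxAverageBound_bbConst hωw₀ hp x₀ hx₀ 3 (by norm_num)
  rw [← hB, hBrestrict] at hbound
  have hBt : nu n α B ≠ ∞ := measure_ne_top _ _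
  have hB0 : nu n α B ≠ 0 := nu_carlesonBox_pos hn hα hx₀ (by norm_num)
  have hv₀i : ∫⁻ x, w₀ x ^ (-1 / (p - 1)) ∂(nu n α) ≠ ∞ := by
    intro h
    rw [h, ENNReal.top_div_of_ne_top hBt, ENNReal.top_rpow_of_pos hp1, ENNReal.mul_top
      (ENNReal.div_pos hw₀0 hBt).ne'] at hbound
    exact (hω.bbConst_lt_top.trans_le hbound).ne rfl
  have hw₀pos : ∀ᵐ x ∂(nu n α), w₀ x ≠ 0 := by
    filter_upwards [ae_lt_top (hw₀m.pow_const _) hv₀i] with x hx h0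
    rw [h0, ENNReal.zero_rpow_of_neg hexp] at hx
    exact hx.ne rfl
  -- The value on the null set where `w₀ = 0` is immaterial.
  set w : E → ℝ≥0∞ := fun x => if w₀ x = 0 then 1 else w₀ x with hw
  have hww₀ : w₀ =ᵐ[nu n α] w := by
    filter_upwards [hw₀pos] with x hx
    simp [hw, hx]
  have hwm : Measurable w :=
    Measurable.ite (hw₀m (measurableSet_singleton 0)) measurable_const hw₀m
  have hw0 : ∀ x, w x ≠ 0 := by
    intro x
    by_cases h : w₀ x = 0 <;> simp [hw, h]
  have hwt : ∀ x, w x ≠ ∞ := by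
    intro x
    by_cases h : w₀ x = 0
    · simp [hw, h]
    · simp only [hw, h, if_false]
      exact ENNReal.ofReal_ne_top
  refine ⟨w, hwm, hw0, hwt, hωw₀.trans hww₀, ?_, ?_, ?_⟩
  · rwa [← lintegral_congr_ae hww₀]
  · have : ∫⁻ x, w x ^ (-1 / (p - 1)) ∂(nu n α) = ∫⁻ x, w₀ x ^ (-1 / (p - 1)) ∂(nu n α) := by
      refine lintegral_congr_ae ?_
      filter_upwards [hww₀] with x hx
      rw [hx]
    rwa [this]
  · have hb := boxAverageBound_bbConst (hωw₀.trans hww₀) hp x₀ hx₀ 3 (by norm_num)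
    intro h
    rw [h, le_zero_iff, ← hB, mul_eq_zero, ENNReal.rpow_eq_zero_iff_of_pos hp1] at hb
    have hvm : Measurable fun x => w x ^ (-1 / (p - 1)) := hwm.pow_const _
    rcases hb with hb | hb
    · exact (ENNReal.div_pos (setLIntegral_ne_zero hwm hw0 hB0) hBt).ne' hb
    · exact (ENNReal.div_pos (setLIntegral_ne_zero hvm (fun x =>
        (ENNReal.rpow_pos (pos_iff_ne_zero.2 (hw0 x)) (hwt x)).ne') hB0) hBt).ne' hb

end OperatorNorm


end BekolleBonami

theorem lemma3p2 (n : ℕ) (hn : 3 ≤ n) (α : ℝ) (hα : -1 < α)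
    (R : (EuclideanSpace ℝ (Fin n) →ₘ[BekolleBonami.nu n α] ℂ) →
      (EuclideanSpace ℝ (Fin n) →ₘ[BekolleBonami.nu n α] ℂ))
    (hR : ∃ C₈ : ℝ≥0, ∀ ω : EuclideanSpace ℝ (Fin n) → ℝ, BekolleBonami.IsBBWeight 2 α ω →
      BekolleBonami.opNorm 2 ω R ≤ C₈ * BekolleBonami.bbConst 2 α ω)
    (p : ℝ) (hp : 2 < p) :
    ∃ C₉ : ℝ≥0, ∀ ω : EuclideanSpace ℝ (Fin n) → ℝ, BekolleBonami.IsBBWeight p α ω →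
      BekolleBonami.opNorm p ω R ≤ C₉ * BekolleBonami.bbConst p α ω := by
  obtain ⟨C₂, hC₂⟩ := hR
  have hp0 : 0 < p := by linarith
  obtain ⟨C, hC⟩ := BekolleBonami.lintegral_rpow_mul_le_of_forall_sq
    (by omega : 2 ≤ n) hα hp C₂
  refine ⟨C, fun ω hω => sInf_le fun f hf => ?_⟩
  rcases eq_or_ne (BekolleBonami.weightedMeasure α ω) 0 with hzero | hzero
  · rw [hzero]; simp
  obtain ⟨w, hw, hw0, hwt, hωw, hwi, hvi, hA0⟩ :=
    BekolleBonami.exists_measurable_pos_representative (by omega) hα (by linarith) hω hzero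
  have hnorm := fun h : EuclideanSpace ℝ (Fin n) →ₘ[BekolleBonami.nu n α] ℂ =>
    BekolleBonami.eLpNorm_weightedMeasure hw hωw hp0 h.measurable
  have hfi := hf.2
  rw [hnorm, ENNReal.rpow_lt_top_iff_of_pos (by positivity)] at hfi
  have key := hC w (fun x => ‖f x‖ₑ) (fun x => ‖R f x‖ₑ) hw hw0 hwt f.measurable.enorm
    (R f).measurable.enorm hwi hvi _ hA0 hω.bbConst_lt_top.ne
    (BekolleBonami.boxAverageBound_bbConst hωw (by linarith))
    (fun Ω hΩ hΩi B hBt hB hfΩ =>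
      BekolleBonami.lintegral_sq_mul_le_of_opNorm_le hC₂ f hΩ hΩi hBt hB hfΩ) hfi.ne
  rw [hnorm, hnorm]
  refine (ENNReal.rpow_le_rpow key (by positivity : 0 ≤ 1 / p)).trans (le_of_eq ?_)
  rw [ENNReal.mul_rpow_of_nonneg _ _ (by positivity), ← ENNReal.rpow_mul,
    mul_one_div_cancel hp0.ne', ENNReal.rpow_one]
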